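/- **Setting.** There are $C\ge 1$ channels and $U$ users, $1\le U\le C$. In slot $k$ channel $i$ is free ($W_i(k)=1$) with probability $\mu_i$ and occupied ($W_i(k)=0$) otherwise, independently over channels and slots; the $\mu_i\in(0,1)$ are distinct. In every slot each user senses exactly one channel and transmits on it iff it is free; a transmission collides iff another user senses the same channel in that slot. For a vector $g\in\mathbb R^C$ let $\sigma(k;g)$ be the index of its $k$-th highest entry (ties go to the smaller index). **Policy $\rho^{\mathrm{EST}}$** with horizon $n$ and real thresholds $\xi(n;k)$. After $m$ slots let $T_{i,j}(m)$ be the number of slots in which user $j$ has sensed channel $i$, let $\bar X_{i,j}(m)$ be the fraction of those in which it was free, and let $g_j(i;m)=\bar X_{i,j}(m)+\sqrt{2\log m/T_{i,j}(m)}$. In the first $C$ slots user $j$ senses every channel once, in an arbitrary fixed order, and records no collisions; it then starts with rank $r_j=1$ and estimate $\widehat U_j=1$ of the number of users. In each later slot $m$ let $g$ denote $g_j(\cdot\,;m-1)$, and 1. if user $j$ has a (non-discarded) recorded collision in slot $m-1$, it draws a new rank $r_j$ uniformly from $\{1,\dots,\widehat U_j\}$, independently of everything else; otherwise it keeps $r_j$;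 2. it senses channel $\sigma(r_j;g)$, transmits if that channel is free, and records a collision if its transmission collides; 3. if the number of its recorded, non-discarded collisions on the channels $\sigma(1;g),\dots,\sigma(\widehat U_j;g)$ exceeds $\xi(n;\widehat U_j)$, it replaces $\widehat U_j$ by $\min(\widehat U_j+1,C)$ and discards all collisions recorded so far, including that of slot $m$. All users run this policy without knowing $U$ or $\mu$. With $V_{i,j}(n)$ the number of the first $n$ slots in which user $j$ is the only user to sense channel $i$, and $\mu(k^*)$ the $k$-th highest entry of $\mu$, the regret is $$R(n)=n\sum_{k=1}^U\mu(k^*)-\sum_{i=1}^C\sum_{j=1}^U\mu_i\,\mathbb E[V_{i,j}(n)] .$$ Put $\xi^*(n;U)=\max_{1\le k\le U}\xi(n;k)$, and write $a(n)=\omega(\log n)$ for $a(n)/\log n\to\infty$. **Theorem.** (a) If $\xi(n;k)=\omega(\log n)$ for all $1<k\le C$ and $\xi^*(n;U)=\omega(\log n)$ (the latter follows from the former when $U\ge2$), then $$\limsup_{n\to\infty}\frac{R(n)}{\xi^*(n;U)}<\infty .$$ (b) For every $f:\mathbb N\to\mathbb R$ with $f(n)\to\infty$ there are thresholds $\xi$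 with $\xi(n;k)=\omega(\log n)$ for all $k>1$, depending on $f$ only, such that for all $C$, all $1\le U\le C$ and all $\mu\in(0,1)^C$ with distinct entries, the regret of $\rho^{\mathrm{EST}}$ with these thresholds is $R(n)=O(f(n)\log n)$. -/

import Mathlib

open Filter Topology MeasureTheory ProbabilityTheory Asymptotics
open scoped unitInterval

namespace CognitiveRadio

noncomputable section

/-- `sigma g k` is the index of the `(k+1)`-th highest entry of `g`
(ranks are counted from `0`; ties are broken in favour of the smaller index). -/
def sigma {C : ℕ} (g : Fin C → ℝ) : Equiv.Perm (Fin C) :=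
  Tuple.sort fun i => -g i

/-- Possible rank draws of one user in one slot: for every `k`, a draw from `{0, …, k}`.
Only the draw that belongs to the user's current estimate `k + 1` of the number of users is used. -/
abbrev Draw (C : ℕ) : Type := (k : Fin C) → Fin (k + 1)

/-- The randomness of one slot: which channels are free of the primary user (`true` = free), and
the rank draws of the `U` users. -/
abbrev Slot (C U : ℕ) : Type := (Fin C → Bool) × (Fin U → Draw C)

/-- The law of one slot: channel `i` is free with probability `μ i`, every draw is uniform, and all
of these are independent. -/
def slotLaw (C U : ℕ) (μ : Fin C → I) : Measure (Slot C U) :=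
  (Measure.pi fun i => bernoulliMeasure true false (μ i)).prod
    (Measure.pi fun _ : Fin U => Measure.pi fun k : Fin C =>
      uniformOn (Set.univ : Set (Fin (k + 1))))

/-- The law of the whole sequence of slots, which are independent and identically distributed. -/
def systemLaw (C U : ℕ) (μ : Fin C → I) : Measure (ℕ → Slot C U) :=
  Measure.infinitePi fun _ => slotLaw C U μ

/-- What one user stores between two slots. -/
structure UserState (C : ℕ) where
  /-- number of slots in which the user has sensed each channel -/
  sensed : Fin C → ℕ
  /-- number of those slots in which the channel was found free -/
  free : Fin C → ℕ
  /-- number of collisions on each channel that have not been discarded -/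
  coll : Fin C → ℕ
  /-- indicator of a (not discarded) collision in the previous slot -/
  flag : Bool
  /-- current rank, counted from `0` -/
  rank : Fin C
  /-- the current estimate of the number of users is `est + 1` -/
  est : Fin C

/-- Initial state: nothing sensed, no collisions, first rank, estimate `1`. -/
def UserState.initial (C : ℕ) [NeZero C] : UserState C where
  sensed _ := 0
  free _ := 0
  coll _ := 0
  flag := false
  rank := 0
  est := 0

variable {C U : ℕ}

/-- The `g`-statistic after `m` slots: sample mean of the availability plus
`√(2 log m / number of times sensed)`. -/
def UserState.gMean (s : UserState C) (m : ℕ) (i : Fin C) : ℝ :=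
  (s.free i : ℝ) / s.sensed i + √(2 * Real.log m / s.sensed i)

/-- The rank used in the next slot: redrawn uniformly among the first `est + 1` ranks after a
collision, kept otherwise. -/
def UserState.nextRank (s : UserState C) (d : Draw C) : Fin C :=
  if s.flag then Fin.castLE s.est.isLt (d s.est) else s.rank

/-- The channel sensed in the slot that follows the first `m` slots. In the first `C` slots the user
senses every channel once, in the order `order`; afterwards it senses the channel whose estimated
rank is the user's current rank. -/
def UserState.nextChannel (s : UserState C) (order : Equiv.Perm (Fin C)) (m : ℕ) (d : Draw C) :
    Fin C :=
  if h : m < C then order ⟨m, h⟩ else sigma (s.gMean m) (s.nextRank d)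

/-- The collision count: not discarded collisions on the channels whose estimated rank is among the
first `est + 1`, where `g` is the statistic that estimates the ranks. -/
def collisionCount (g : Fin C → ℝ) (coll : Fin C → ℕ) (est : Fin C) : ℕ :=
  ∑ k ∈ Finset.Iic est, coll (sigma g k)

/-- The estimate is raised by one, but never above the number `C` of channels. -/
def raise (e : Fin C) : Fin C :=
  if h : (e : ℕ) + 1 < C then ⟨e + 1, h⟩ else e

/-- The state after a slot that follows the first `m` slots, where the user sensed channel `c`,
`isFree` tells whether `c` was free, `hit` whether the user's transmission collided, and `thr k` is
the threshold for the estimate `k`. Collisions in the first `C` slots are not recorded. When the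
collision count exceeds the threshold, the estimate is raised and all collisions recorded so far,
including that of the present slot, are discarded. -/
def UserState.update (s : UserState C) (thr : ℕ → ℝ) (m : ℕ) (d : Draw C) (c : Fin C)
    (isFree hit : Bool) : UserState C :=
  let sensed' := Function.update s.sensed c (s.sensed c + 1)
  let free' := if isFree then Function.update s.free c (s.free c + 1) else s.free
  if m < C then { s with sensed := sensed', free := free' }
  else
    let coll' := if hit then Function.update s.coll c (s.coll c + 1) else s.coll
    open Classical in
    if thr (s.est + 1) < (collisionCount (s.gMean m) coll' s.est : ℝ) then
      { sensed := sensed', free := free', coll := fun _ => 0, flag := false,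
        rank := s.nextRank d, est := raise s.est }
    else
      { sensed := sensed', free := free', coll := coll', flag := hit,
        rank := s.nextRank d, est := s.est }

/-- The channels sensed by all users in the slot that follows the first `m` slots. -/
def channels (order : Fin U → Equiv.Perm (Fin C)) (m : ℕ) (s : Fin U → UserState C)
    (x : Slot C U) (j : Fin U) : Fin C :=
  (s j).nextChannel (order j) m (x.2 j)

/-- User `j` is the only one that senses its channel. -/
def Sole (c : Fin U → Fin C) (j : Fin U) : Prop := ∀ j', j' ≠ j → c j' ≠ c j

open Classical in
/-- One slot of the system. A user transmits iff the channel it senses is free, so its transmission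
collides iff the channel is free and another user senses it too. -/
def step (thr : ℕ → ℝ) (order : Fin U → Equiv.Perm (Fin C)) (m : ℕ)
    (s : Fin U → UserState C) (x : Slot C U) (j : Fin U) : UserState C :=
  let c := channels order m s x
  (s j).update thr m (x.2 j) (c j) (x.1 (c j)) (x.1 (c j) && !decide (Sole c j))

/-- The states of the users after `m` slots, when the slots evolve as in `ω`. -/
def states [NeZero C] (thr : ℕ → ℝ) (order : Fin U → Equiv.Perm (Fin C)) (ω : ℕ → Slot C U) :
    ℕ → Fin U → UserState C
  | 0 => fun _ => UserState.initial C
  | m + 1 => step thr order m (states thr order ω m) (ω m)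

/-- The channel sensed by user `j` in slot `m` (slots are counted from `0`). -/
def channelAt [NeZero C] (thr : ℕ → ℝ) (order : Fin U → Equiv.Perm (Fin C)) (ω : ℕ → Slot C U)
    (m : ℕ) : Fin U → Fin C :=
  channels order m (states thr order ω m) (ω m)

open Classical in
/-- `V i j n`: the number of the first `n` slots in which user `j` is the sole user to sense
channel `i`. -/
def soleCount [NeZero C] (thr : ℕ → ℝ) (order : Fin U → Equiv.Perm (Fin C)) (n : ℕ) (i : Fin C)
    (j : Fin U) (ω : ℕ → Slot C U) : ℕ :=
  ((Finset.range n).filter fun m =>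
    channelAt thr order ω m j = i ∧ Sole (channelAt thr order ω m) j).card

/-- The regret with horizon `n`, when all `U` users run the policy with horizon `n` and
thresholds `ξ n k`. -/
def regret (C U : ℕ) [NeZero C] (μ : Fin C → I) (order : Fin U → Equiv.Perm (Fin C))
    (ξ : ℕ → ℕ → ℝ) (n : ℕ) : ℝ :=
  n * (∑ k ∈ Finset.univ.filter (fun k : Fin C => k.val < U),
      (μ (sigma (fun i => (μ i : ℝ)) k) : ℝ)) -
    ∑ i : Fin C, ∑ j : Fin U,
      (μ i : ℝ) * ∫ ω, (soleCount (ξ n) order n i j ω : ℝ) ∂(systemLaw C U μ)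

/-- `max_{k = 1, …, U} ξ n k`, for `U ≥ 1`. -/
def maxThreshold (ξ : ℕ → ℕ → ℝ) (U n : ℕ) : ℝ := ⨆ k : Fin U, ξ n (k + 1)

/-- `f(n) = ω(log n)`. -/
def SuperLog (f : ℕ → ℝ) : Prop := Tendsto (fun n => f n / Real.log n) atTop atTop

end

end CognitiveRadio

/-! Fix a sampling level `L` of order `log n`. Call the system alive as long as the means of all
channels sensed at least `L` times are `ε`-accurate and no user whose estimate equals `U` has
exceeded its threshold. While it is alive no estimate passes `U`, and loss has only a few sources:
the start-up slots, slots sensing an undersampled channel (at most `U * (C * L + C)`), slots in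
which some index lies below its mean (`O(1)` in expectation), and shared channels. A shared channel
is free with probability bounded below, so shared slots are controlled by collisions, and these by
the thresholds: a user goes through at most `U` estimates and collects at most `C * X + 1`
collisions under each, `X` being the largest threshold. What remains is to show that the system dies
with probability `O(1/n)` (`sum_loss_le`, `hitCount_le`).

Inaccuracy is excluded by an exponential supermartingale. The main difficulty is overestimation.
Users with too small an estimate draw from too few ranks, so a collision-free assignment of all
users need not exist. A deficiency form of Hall's theorem (`exists_partial_matching`) still selects
"settlers" with distinct goal channels that no other user's window contains; every user with
estimate `U` is a settler. Whenever settlers redraw, all of them hit their goals with probability at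
least `C⁻ᵁ`.

The goals change when the index orderings change. Between senses an index grows faster the less its
channel has been sampled, so as long as well-sampled channels are sensed and the channel at each
user's rank remains well-sampled, every change of ordering destroys an inversion
(`ordering_dichotomy`). This yields a bounded potential which, at every redraw by settlers, drops
with probability at least `C⁻ᵁ`, except where the `O(log n)` budget of undersampled senses and
estimate increases is spent. By `integral_potential_le` the number of relevant slots has an
exponential moment of at most `2 * 2 ^ budget`, with a base greater than `1` depending only on `C`
and `U`. The collisions of a user with estimate `U` are counted by these slots, so a
superlogarithmic threshold at `U` is exceeded with probability `O(1/n)`. -/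

namespace CognitiveRadio

/-! ### Independence of slots, and an exponential moment bound from a potential with a budget. -/

section Probability

variable {C U : ℕ} {μ : Fin C → I}

instance isProbabilityMeasure_slotLaw : IsProbabilityMeasure (slotLaw C U μ) := by
  unfold slotLaw; infer_instance

instance isProbabilityMeasure_systemLaw : IsProbabilityMeasure (systemLaw C U μ) := by
  unfold systemLaw; infer_instance

/-- A function of the first `m` slots factors through the restriction to these slots. -/
lemma exists_eq_comp_restrict {α : Type*} {m : ℕ} {f : (ℕ → Slot C U) → α}
    (hf : DependsOn f (Set.Iio m)) :
    ∃ g : (Finset.range m → Slot C U) → α, ∀ ω, f ω = g ((Finset.range m).restrict ω) := by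
  classical
  refine ⟨fun a => f fun t => if h : t ∈ Finset.range m then a ⟨t, h⟩ else default, fun ω => ?_⟩
  refine hf fun t ht => ?_
  have : t ∈ Finset.range m := Finset.mem_range.2 ht
  simp only [this, dite_true, Finset.restrict]

/-- Finitely many slots take only finitely many values, so dependence on them already gives
measurability and boundedness. -/
lemma integrable_of_dependsOn {m : ℕ} {f : (ℕ → Slot C U) → ℝ} (hf : DependsOn f (Set.Iio m)) :
    Integrable f (systemLaw C U μ) := by
  obtain ⟨g, hg⟩ := exists_eq_comp_restrict hf
  have hm : Measurable ((Finset.range m).restrict : (ℕ → Slot C U) → _) :=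
    Finset.measurable_restrict _
  have : f = g ∘ (Finset.range m).restrict := funext hg
  rw [this]
  have : IsProbabilityMeasure ((systemLaw C U μ).map (Finset.range m).restrict) :=
    Measure.isProbabilityMeasure_map hm.aemeasurable
  exact (Integrable.of_finite (f := g)).comp_measurable hm

/-- The slot `m` is independent of the slots before it. -/
lemma integral_slot_eq {m : ℕ} {F : (ℕ → Slot C U) → Slot C U → ℝ}
    (hF : DependsOn F (Set.Iio m)) :
    ∫ ω, F ω (ω m) ∂(systemLaw C U μ) = ∫ ω, ∫ x, F ω x ∂(slotLaw C U μ) ∂(systemLaw C U μ) := by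
  obtain ⟨g, hg⟩ := exists_eq_comp_restrict hF
  have hm : Measurable ((Finset.range m).restrict : (ℕ → Slot C U) → _) :=
    Finset.measurable_restrict _
  have he : Measurable fun ω : ℕ → Slot C U => ω m := measurable_pi_apply m
  have hind : iIndepFun (fun (i : ℕ) (ω : ℕ → Slot C U) => ω i) (systemLaw C U μ) :=
    iIndepFun_infinitePi (P := fun _ => slotLaw C U μ) (X := fun _ x => x) fun _ => measurable_id
  have h2 := hind.indepFun_finset (Finset.range m) {m} (by simp) fun i => measurable_pi_apply i
  have h3 : IndepFun ((Finset.range m).restrict : (ℕ → Slot C U) → _) (fun ω => ω m)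
      (systemLaw C U μ) :=
    h2.comp (φ := id) (ψ := fun a : ({m} : Finset ℕ) → Slot C U => a ⟨m, by simp⟩)
      measurable_id (measurable_pi_apply _)
  have h4 := (indepFun_iff_map_prod_eq_prod_map_map hm.aemeasurable he.aemeasurable).1 h3
  have h5 : (systemLaw C U μ).map (fun ω => ω m) = slotLaw C U μ :=
    Measure.infinitePi_map_eval (fun _ => slotLaw C U μ) m
  have : IsProbabilityMeasure ((systemLaw C U μ).map (Finset.range m).restrict) :=
    Measure.isProbabilityMeasure_map hm.aemeasurable
  simp only [hg]
  calc ∫ ω, g ((Finset.range m).restrict ω) (ω m) ∂(systemLaw C U μ)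
      = ∫ p, g p.1 p.2 ∂((systemLaw C U μ).map
          fun ω => ((Finset.range m).restrict ω, ω m)) := by
        rw [integral_map (hm.prodMk he).aemeasurable]
        exact (Measurable.of_discrete).aestronglyMeasurable
    _ = ∫ a, ∫ x, g a x ∂(slotLaw C U μ) ∂((systemLaw C U μ).map (Finset.range m).restrict) := by
        rw [h4, h5, integral_prod]
        exact Integrable.of_finite
    _ = _ := by
        rw [integral_map hm.aemeasurable]
        exact (Measurable.of_discrete).aestronglyMeasurable

/-- Given the draws, the channel `c` is free with probability `μ c`. -/
lemma integral_slotLaw_eq (ψ : (Fin U → Draw C) → Bool → ℝ) (c : (Fin U → Draw C) → Fin C) :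
    ∫ x, ψ x.2 (x.1 (c x.2)) ∂(slotLaw C U μ) =
      ∫ x, ((μ (c x.2) : ℝ) * ψ x.2 true + (1 - (μ (c x.2) : ℝ)) * ψ x.2 false)
        ∂(slotLaw C U μ) := by
  unfold slotLaw
  rw [integral_prod_symm _ Integrable.of_finite, integral_prod_symm _ Integrable.of_finite]
  congr 1
  funext d
  have h := (measurePreserving_eval (fun i => bernoulliMeasure true false (μ i)) (c d)).map_eq
  calc ∫ w, ψ d (w (c d)) ∂(Measure.pi fun i => bernoulliMeasure true false (μ i))
      = ∫ b, ψ d b ∂((Measure.pi fun i => bernoulliMeasure true false (μ i)).map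
          (Function.eval (c d))) := by
        rw [integral_map (Measurable.of_discrete).aemeasurable
          (Measurable.of_discrete).aestronglyMeasurable]
    _ = _ := by
        rw [h, integral_bernoulliMeasure]
        simp

/-- The bound is uniform in the estimates: each prescribed rank has probability `1 / (e j + 1) ≥ 1 /
C`, independently over users. It supplies the success probability `δ` of the supermartingale. -/
lemma le_slotLaw_real_draws (e : Fin U → Fin C) (v : (j : Fin U) → Fin (e j + 1)) :
    (1 / (C : ℝ)) ^ U ≤ (slotLaw C U μ).real {x | ∀ j, x.2 j (e j) = v j} := by
  have hset : {x : Slot C U | ∀ j, x.2 j (e j) = v j} =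
      Set.univ ×ˢ Set.univ.pi fun j => {d : Draw C | d (e j) = v j} := by
    ext x; simp
  have hone (j : Fin U) : ((Measure.pi fun k : Fin C =>
      uniformOn (Set.univ : Set (Fin (k + 1))))).real {d : Draw C | d (e j) = v j} =
      1 / ((e j : ℝ) + 1) := by
    have h := (measurePreserving_eval
      (fun k : Fin C => uniformOn (Set.univ : Set (Fin (k + 1)))) (e j)).measure_preimage
        (MeasurableSet.of_discrete (s := {v j})).nullMeasurableSet
    have h' : {d : Draw C | d (e j) = v j} = (fun d : Draw C => d (e j)) ⁻¹' {v j} := by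
      ext d; simp
    rw [measureReal_def, h']
    refine (congrArg ENNReal.toReal h).trans ?_
    rw [uniformOn_univ]
    simp [ENNReal.toReal_add]
  unfold slotLaw
  rw [hset, measureReal_prod_prod, measureReal_def, measureReal_def, Measure.pi_pi]
  simp only [measure_univ, ENNReal.toReal_one, one_mul, ENNReal.toReal_prod]
  simp only [← measureReal_def, hone]
  calc (1 / (C : ℝ)) ^ U = ∏ _j : Fin U, (1 / (C : ℝ)) := by simp
    _ ≤ _ := by
      refine Finset.prod_le_prod (fun _ _ => by positivity) fun j _ => ?_
      have : (e j : ℝ) + 1 ≤ C := by exact_mod_cast (e j).isLt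
      exact one_div_le_one_div_of_le (by positivity) this

/-- The weight of the potential `φ` in the supermartingale of `integral_potential_le`. -/
noncomputable def weight (δ : ℝ) (φ : ℕ) : ℝ := 1 + δ / 4 * (1 - (δ / 2) ^ φ)

/-- The base of the exponential moment in `integral_potential_le`. -/
noncomputable def base (δ : ℝ) (D : ℕ) : ℝ := (1 - δ / 8 * (δ / 2) ^ D)⁻¹

variable {δ : ℝ}

lemma one_le_weight (h0 : 0 < δ) (h1 : δ ≤ 1) (φ : ℕ) : 1 ≤ weight δ φ := by
  have : (δ / 2) ^ φ ≤ 1 := pow_le_one₀ (by linarith) (by linarith)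
  unfold weight
  nlinarith

lemma weight_le (h0 : 0 < δ) (φ : ℕ) : weight δ φ ≤ 1 + δ / 4 := by
  have : 0 ≤ (δ / 2) ^ φ := by positivity
  unfold weight
  nlinarith

lemma weight_mono (h0 : 0 < δ) (h1 : δ ≤ 1) {φ ψ : ℕ} (h : φ ≤ ψ) : weight δ φ ≤ weight δ ψ := by
  have : (δ / 2) ^ ψ ≤ (δ / 2) ^ φ :=
    pow_le_pow_of_le_one (by linarith) (by linarith) h
  unfold weight
  nlinarith

lemma base_aux (h0 : 0 < δ) (h1 : δ ≤ 1) (D : ℕ) :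
    0 < δ / 8 * (δ / 2) ^ D ∧ δ / 8 * (δ / 2) ^ D ≤ δ / 8 := by
  have : (δ / 2) ^ D ≤ 1 := pow_le_one₀ (by linarith) (by linarith)
  have : 0 < (δ / 2) ^ D := by positivity
  constructor
  · positivity
  · nlinarith

lemma one_lt_base (h0 : 0 < δ) (h1 : δ ≤ 1) (D : ℕ) : 1 < base δ D := by
  have := base_aux h0 h1 D
  exact one_lt_inv₀ (by linarith) |>.2 (by linarith)

/-- A failure may send the potential anywhere, so it is charged the supremum `1 + δ / 4` of the
weights. With geometric weights of ratio `δ / 2` a success still leaves the margin `δ / 4 * (δ / 2)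
^ (φ + 1)`; `base` is chosen to fit into it for every `φ < D`. -/
lemma base_mul_le (h0 : 0 < δ) (h1 : δ ≤ 1) {D φ : ℕ} (hφ : φ + 1 ≤ D) :
    base δ D * (δ * weight δ φ + (1 - δ) * (1 + δ / 4)) ≤ weight δ (φ + 1) := by
  have hb := base_aux h0 h1 D
  have h3 : (δ / 2) ^ D ≤ (δ / 2) ^ (φ + 1) :=
    pow_le_pow_of_le_one (by linarith) (by linarith) hφ
  unfold base weight
  rw [inv_mul_le_iff₀ (by linarith)]
  have h4 : (δ / 2) ^ (φ + 1) = (δ / 2) ^ φ * (δ / 2) := pow_succ _ _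
  have h5 : 0 < (δ / 2) ^ φ := by positivity
  have h6 : 0 < (δ / 2) ^ D := by positivity
  have h7 : 0 < (δ / 2) ^ (φ + 1) := by positivity
  have e1 : δ * (1 + δ / 4 * (1 - (δ / 2) ^ φ)) + (1 - δ) * (1 + δ / 4) =
      1 + δ / 4 - δ / 2 * (δ / 2) ^ (φ + 1) := by rw [h4]; ring
  rw [e1]
  have h8 : δ / 8 * (δ / 2) ^ D ≤ δ / 8 * (δ / 2) ^ (φ + 1) := by gcongr
  nlinarith [mul_pos hb.1 h0, mul_pos (mul_pos hb.1 h0) h7]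

/-- A budget increase halves the process, which outweighs any rise of the weight, even from the
minimal weight `1`. -/
lemma base_mul_le_one (h0 : 0 < δ) (h1 : δ ≤ 1) (D : ℕ) :
    base δ D * (δ * ((1 + δ / 4) / 2) + (1 - δ) * (1 + δ / 4)) ≤ 1 := by
  have hb := base_aux h0 h1 D
  unfold base
  rw [inv_mul_le_iff₀ (by linarith)]
  nlinarith

/-- If a random variable is at most `b` on an event of probability at least `δ` and at most `B`
everywhere, then its mean is at most `δ b + (1 - δ) B`. -/
lemma integral_slotLaw_le (f : Slot C U → ℝ) {A : Set (Slot C U)} {b B : ℝ}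
    (hA : δ ≤ (slotLaw C U μ).real A) (hb : ∀ x ∈ A, f x ≤ b) (hB : ∀ x, f x ≤ B) (hbB : b ≤ B) :
    ∫ x, f x ∂(slotLaw C U μ) ≤ δ * b + (1 - δ) * B := by
  have hm : MeasurableSet A := MeasurableSet.of_discrete
  calc ∫ x, f x ∂(slotLaw C U μ)
      ≤ ∫ x, (B - A.indicator (fun _ => B - b) x) ∂(slotLaw C U μ) := by
        refine integral_mono Integrable.of_finite Integrable.of_finite fun x => ?_
        by_cases hx : x ∈ A
        · simpa [hx] using hb x hx
        · simpa [hx] using hB x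
    _ = B - (slotLaw C U μ).real A * (B - b) := by
        rw [integral_sub Integrable.of_finite Integrable.of_finite, integral_indicator_const _ hm]
        simp
    _ ≤ _ := by nlinarith

/-- Suppose that a potential `Φ ≤ D` does not increase, except in slots in which the budget `B`
increases and in slots counted by `N`, and that in each of the latter, with probability at
least `δ`, the budget increases or the potential decreases. Then the count `N` has an exponential
moment relative to the budget. -/
theorem integral_potential_le (h0 : 0 < δ) (h1 : δ ≤ 1) {D : ℕ}
    {N B Φ : ℕ → (ℕ → Slot C U) → ℕ} {R : ℕ → (ℕ → Slot C U) → Prop}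
    (dN : ∀ m, DependsOn (N m) (Set.Iio m)) (dB : ∀ m, DependsOn (B m) (Set.Iio m))
    (dΦ : ∀ m, DependsOn (Φ m) (Set.Iio m)) (hN0 : ∀ ω, N 0 ω = 0)
    (hN : ∀ m ω, R m ω → N (m + 1) ω = N m ω + 1) (hN' : ∀ m ω, ¬ R m ω → N (m + 1) ω = N m ω)
    (hB : ∀ m ω, B m ω ≤ B (m + 1) ω) (hΦ : ∀ m ω, Φ m ω ≤ D)
    (hR : ∀ m ω, R m ω → ∃ A : Set (Slot C U), δ ≤ (slotLaw C U μ).real A ∧ ∀ x ∈ A,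
      B m ω < B (m + 1) (Function.update ω m x) ∨
        Φ (m + 1) (Function.update ω m x) + 1 ≤ Φ m ω)
    (hR' : ∀ m ω, ¬ R m ω → B m ω < B (m + 1) ω ∨ Φ (m + 1) ω ≤ Φ m ω)
    (dR : ∀ m, DependsOn (R m) (Set.Iio m)) (n : ℕ) :
    ∫ ω, base δ D ^ N n ω * ((1 / 2) ^ B n ω * weight δ (Φ n ω)) ∂(systemLaw C U μ) ≤ 2 := by
  have hb := one_lt_base h0 h1 D
  have hb0 : 0 < base δ D := by linarith
  set Z : ℕ → (ℕ → Slot C U) → ℝ :=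
    fun m ω => base δ D ^ N m ω * ((1 / 2) ^ B m ω * weight δ (Φ m ω)) with hZ
  have dZ (m : ℕ) : DependsOn (Z m) (Set.Iio m) := fun ω ω' h => by
    simp only [hZ, dN m h, dB m h, dΦ m h]
  change ∫ ω, Z n ω ∂(systemLaw C U μ) ≤ 2
  induction n with
  | zero =>
    calc ∫ ω, Z 0 ω ∂(systemLaw C U μ) ≤ ∫ _, (2 : ℝ) ∂(systemLaw C U μ) := by
          refine integral_mono (integrable_of_dependsOn (dZ 0)) (integrable_const _) fun ω => ?_
          have h2 : (1 / 2 : ℝ) ^ B 0 ω ≤ 1 := pow_le_one₀ (by norm_num) (by norm_num)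
          have h3 := weight_le h0 (Φ 0 ω)
          have h4 := one_le_weight h0 h1 (Φ 0 ω)
          simp only [hZ, hN0, pow_zero, one_mul]
          have h5 : (0 : ℝ) < (1 / 2) ^ B 0 ω := by positivity
          nlinarith
      _ = 2 := by simp
  | succ m ih =>
    refine le_trans ?_ ih
    -- Slot `m` is replaced by a fresh `x`, so integrating over `x` conditions on the past.
    have dF : DependsOn (fun ω x => Z (m + 1) (Function.update ω m x)) (Set.Iio m) :=
      fun ω ω' h => by
        funext x
        refine dZ (m + 1) fun t ht => ?_
        rcases (Nat.lt_succ_iff.1 ht).lt_or_eq with h' | h'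
        · simp [h'.ne, h t h']
        · simp [h']
    have h2 := integral_slot_eq (μ := μ) dF
    simp only [Function.update_eq_self] at h2
    rw [h2]
    refine integral_mono (integrable_of_dependsOn (m := m) fun ω ω' h => ?_)
      (integrable_of_dependsOn (dZ m)) fun ω => ?_
    · exact congrArg (fun f => ∫ x, f x ∂(slotLaw C U μ)) (dF h)
    have hup (x : Slot C U) : ∀ t ∈ Set.Iio m, Function.update ω m x t = ω t := fun t ht => by
      simp [(Set.mem_Iio.1 ht).ne]
    have hNx (x : Slot C U) : N m (Function.update ω m x) = N m ω := dN m (hup x)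
    have hBx (x : Slot C U) : B m (Function.update ω m x) = B m ω := dB m (hup x)
    have hΦx (x : Slot C U) : Φ m (Function.update ω m x) = Φ m ω := dΦ m (hup x)
    have hRx (x : Slot C U) : R m (Function.update ω m x) = R m ω := dR m (hup x)
    have hhalf {x : Slot C U} (h : B m ω < B (m + 1) (Function.update ω m x)) :
        (1 / 2 : ℝ) ^ B (m + 1) (Function.update ω m x) ≤ (1 / 2) ^ B m ω * (1 / 2) := by
      rw [← pow_succ]
      exact pow_le_pow_of_le_one (by norm_num) (by norm_num) h
    have hle (x : Slot C U) :
        (1 / 2 : ℝ) ^ B (m + 1) (Function.update ω m x) ≤ (1 / 2) ^ B m ω := by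
      have := hB m (Function.update ω m x)
      rw [hBx] at this
      exact pow_le_pow_of_le_one (by norm_num) (by norm_num) this
    have hp : (0 : ℝ) < (1 / 2) ^ B m ω := by positivity
    have hpN : 0 < base δ D ^ N m ω := by positivity
    have hw := one_le_weight h0 h1 (Φ m ω)
    by_cases hr : R m ω
    · obtain ⟨A, hA, hA'⟩ := hR m ω hr
      have hNs (x : Slot C U) : N (m + 1) (Function.update ω m x) = N m ω + 1 := by
        rw [hN m _ (by rwa [hRx]), hNx]
      -- `b` bounds the new weight on the success event whichever alternative occurs; in the budget
      -- alternative the factor `1 / 2` is included.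
      have key (b : ℝ) (hb1 : (1 + δ / 4) / 2 ≤ b) (hb2 : b ≤ 1 + δ / 4)
          (hb3 : ∀ k, k + 1 ≤ Φ m ω → weight δ k ≤ b)
          (hb4 : base δ D * (δ * b + (1 - δ) * (1 + δ / 4)) ≤ weight δ (Φ m ω)) :
          ∫ x, Z (m + 1) (Function.update ω m x) ∂(slotLaw C U μ) ≤ Z m ω := by
        set K : ℝ := base δ D ^ (N m ω + 1) * (1 / 2) ^ B m ω with hK
        have hK0 : 0 < K := by positivity
        have hZK (x : Slot C U) (b' : ℝ)
            (h : (1 / 2 : ℝ) ^ B (m + 1) (Function.update ω m x) *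
              weight δ (Φ (m + 1) (Function.update ω m x)) ≤ (1 / 2) ^ B m ω * b') :
            Z (m + 1) (Function.update ω m x) ≤ K * b' := by
          simp only [hZ, hNs, hK, mul_assoc]
          gcongr
        have hall (x : Slot C U) : Z (m + 1) (Function.update ω m x) ≤ K * (1 + δ / 4) :=
          hZK x _ (mul_le_mul (hle x) (weight_le h0 _)
            (zero_le_one.trans (one_le_weight h0 h1 _)) hp.le)
        refine (integral_slotLaw_le (fun x => Z (m + 1) (Function.update ω m x)) (b := K * b)
          hA (fun x hx => hZK x b ?_) hall (by gcongr)).trans ?_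
        · rcases hA' x hx with h | h
          · calc _ ≤ (1 / 2) ^ B m ω * (1 / 2) * (1 + δ / 4) :=
                mul_le_mul (hhalf h) (weight_le h0 _)
                  (zero_le_one.trans (one_le_weight h0 h1 _)) (by positivity)
              _ = (1 / 2) ^ B m ω * ((1 + δ / 4) / 2) := by ring
              _ ≤ _ := by gcongr
          · exact mul_le_mul (hle x) (hb3 _ h) (zero_le_one.trans (one_le_weight h0 h1 _)) hp.le
        · calc δ * (K * b) + (1 - δ) * (K * (1 + δ / 4))
              = base δ D ^ N m ω * ((1 / 2) ^ B m ω *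
                (base δ D * (δ * b + (1 - δ) * (1 + δ / 4)))) := by rw [hK, pow_succ]; ring
            _ ≤ _ := by simp only [hZ]; gcongr
      rcases Nat.eq_zero_or_pos (Φ m ω) with h | h
      -- At potential zero no decrease is possible, so success means that the budget grows.
      · refine key ((1 + δ / 4) / 2) le_rfl (by linarith) (fun k hk => by omega) ?_
        exact (base_mul_le_one h0 h1 D).trans hw
      · obtain ⟨φ, hφ⟩ := Nat.exists_eq_add_of_lt h
        simp only [zero_add] at hφ
        refine key (weight δ φ) ?_ (weight_le h0 _) (fun k hk => ?_) ?_
        · have := one_le_weight h0 h1 φ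
          linarith
        · exact weight_mono h0 h1 (by omega)
        · rw [hφ]
          exact base_mul_le h0 h1 (hφ ▸ hΦ m ω)
    · have hpt (x : Slot C U) : Z (m + 1) (Function.update ω m x) ≤ Z m ω := by
        have hNs : N (m + 1) (Function.update ω m x) = N m ω := by
          rw [hN' m _ (by rwa [hRx]), hNx]
        simp only [hZ, hNs]
        gcongr ?_ * ?_
        have h3 := hR' m (Function.update ω m x) (by rwa [hRx])
        rw [hBx, hΦx] at h3
        rcases h3 with h | h
        · calc _ ≤ (1 / 2) ^ B m ω * (1 / 2) * (1 + δ / 4) :=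
                mul_le_mul (hhalf h) (weight_le h0 _)
                  (zero_le_one.trans (one_le_weight h0 h1 _)) (by positivity)
              _ = (1 / 2) ^ B m ω * ((1 + δ / 4) / 2) := by ring
              _ ≤ _ := by gcongr; linarith
        · exact mul_le_mul (hle x) (weight_mono h0 h1 h)
            (zero_le_one.trans (one_le_weight h0 h1 _)) hp.le
      calc _ ≤ ∫ _, Z m ω ∂(slotLaw C U μ) :=
            integral_mono Integrable.of_finite (integrable_const _) hpt
        _ = _ := by simp

/-- Markov's inequality for a nonnegative function of finitely many slots. -/
lemma systemLaw_real_le {m : ℕ} {f : (ℕ → Slot C U) → ℝ} (hf : DependsOn f (Set.Iio m))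
    (h : ∀ ω, 0 ≤ f ω) {E : Set (ℕ → Slot C U)} {c b : ℝ} (hc : 0 < c) (hE : ∀ ω ∈ E, c ≤ f ω)
    (hb : ∫ ω, f ω ∂(systemLaw C U μ) ≤ b) : (systemLaw C U μ).real E ≤ b / c := by
  rw [le_div_iff₀ hc, mul_comm]
  refine le_trans ?_ ((mul_meas_ge_le_integral_of_nonneg (Eventually.of_forall h)
    (integrable_of_dependsOn hf) c).trans hb)
  have : (systemLaw C U μ).real E ≤ (systemLaw C U μ).real {ω | c ≤ f ω} :=
    measureReal_mono fun ω hω => hE ω hω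
  gcongr

end Probability

/-! ### Combinatorics of changing orderings, and a deficiency version of Hall's theorem. -/

section Ordering

variable {C U : ℕ}

lemma sigma_symm_lt_iff (g : Fin C → ℝ) (x z : Fin C) :
    (sigma g).symm x < (sigma g).symm z ↔ g z < g x ∨ (g x = g z ∧ x < z) := by
  obtain ⟨hmono, htie⟩ := Tuple.eq_sort_iff.1 (rfl : sigma g = Tuple.sort fun i => -g i)
  have key (x z : Fin C) (h : (sigma g).symm x < (sigma g).symm z) :
      g z < g x ∨ (g x = g z ∧ x < z) := by
    have h1 := hmono h.le
    have h2 := htie _ _ h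
    simp only [Function.comp_apply, Equiv.apply_symm_apply, neg_le_neg_iff, neg_inj] at h1 h2
    rcases h1.lt_or_eq with h3 | h3
    · exact Or.inl h3
    · exact Or.inr ⟨h3.symm, h2 h3.symm⟩
  refine ⟨key x z, fun h => ?_⟩
  by_contra hn
  rcases (not_lt.1 hn).lt_or_eq with h' | h'
  · rcases key z x h' with h2 | h2 <;> rcases h with h3 | h3
    · linarith
    · linarith [h3.1]
    · linarith [h2.1]
    · exact absurd h2.2 h3.2.asymm
  · have : z = x := (sigma g).symm.injective h'
    subst this
    simp at h

lemma card_filter_perm_lt (p : Equiv.Perm (Fin C)) (e : Fin C) :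
    (Finset.univ.filter fun z => p z < p e).card = (p e : ℕ) := by
  rw [← Fin.card_Iio (p e)]
  refine Finset.card_bij (fun z _ => p z) (fun z hz => by simpa using hz)
    (fun a _ b _ h => p.injective h) fun b hb => ⟨p.symm b, by simpa using hb, by simp⟩

lemma perm_eq_of_lt_iff {p q : Equiv.Perm (Fin C)} (h : ∀ x z, p x < p z ↔ q x < q z) : p = q := by
  refine Equiv.ext fun e => Fin.ext ?_
  rw [← card_filter_perm_lt p, ← card_filter_perm_lt q]
  simp only [h]

/-- For positions `p` and counts `T`, the pairs in which the channel with the smaller count,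
below `L`, stands behind the other one. -/
def inversions (L : ℕ) (p : Equiv.Perm (Fin C)) (T : Fin C → ℕ) : Finset (Fin C × Fin C) :=
  Finset.univ.filter fun q => T q.1 < T q.2 ∧ T q.1 < L ∧ p q.2 < p q.1

lemma mem_inversions {L : ℕ} {p : Equiv.Perm (Fin C)} {T : Fin C → ℕ} {x z : Fin C} :
    (x, z) ∈ inversions L p T ↔ T x < T z ∧ T x < L ∧ p z < p x := by
  simp [inversions]

/-- When a well-sampled channel `c` is sensed, either the next channel in its position is not
well-sampled, or the ordering stays the same, or the number of inversions decreases. -/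
theorem ordering_dichotomy {L : ℕ} {p p' : Equiv.Perm (Fin C)} {T T' : Fin C → ℕ} {c : Fin C}
    (hc : L ≤ T c) (hT' : T' = Function.update T c (T c + 1))
    (hmono : ∀ x z, x ≠ c → z ≠ c → T x ≤ T z → p x < p z → p' x < p' z)
    (hwell : ∀ x z, L ≤ T x → L ≤ T z → (p x < p z ↔ p' x < p' z))
    (hnext : L ≤ T' (p'.symm (p c))) :
    (p' = p ∧ (inversions L p' T').card = (inversions L p T).card) ∨
      (inversions L p' T').card < (inversions L p T).card := by
  have hmem (x z : Fin C) :
      (x, z) ∈ inversions L p' T' ↔ T x < T z ∧ T x < L ∧ p' z < p' x := by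
    rw [mem_inversions, hT']
    by_cases hx : x = c
    · subst hx
      simp only [Function.update_self]
      constructor <;> intro h <;> omega
    · by_cases hz : z = c
      · subst hz
        simp only [Function.update_self, Function.update_of_ne hx]
        constructor <;> intro h <;> refine ⟨?_, h.2⟩ <;> omega
      · simp [hx, hz]
  have hne {x z : Fin C} (h : x ≠ z) : p x < p z ∨ p z < p x :=
    lt_or_gt_of_ne (p.injective.ne h)
  have hne' {x z : Fin C} (h : x ≠ z) : p' x < p' z ∨ p' z < p' x :=
    lt_or_gt_of_ne (p'.injective.ne h)
  have hold {x z : Fin C} (hz : z ≠ c) (h : (x, z) ∈ inversions L p' T') :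
      (x, z) ∈ inversions L p T := by
    rw [hmem] at h
    rw [mem_inversions]
    have hx : x ≠ c := by rintro rfl; omega
    refine ⟨h.1, h.2.1, ?_⟩
    rcases hne (show x ≠ z by rintro rfl; omega) with h' | h'
    · exact absurd (hmono x z hx hz h.1.le h') h.2.2.asymm
    · exact h'
  -- First case: some `w` overtakes `c`. It must be undersampled, since well-sampled pairs keep
  -- their order.
  by_cases hju : ∃ w, p c < p w ∧ p' w < p' c
  · right
    obtain ⟨w, hw, hw'⟩ := hju
    have hwL : T w < L := by
      by_contra h
      exact absurd ((hwell c w hc (not_lt.1 h)).1 hw) hw'.asymm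
    have hwc : w ≠ c := by rintro rfl; exact lt_irrefl _ hw
    set A := inversions L p T
    set A' := inversions L p' T'
    have h1 : (A' \ A).card < (A \ A').card := by
      -- New inversions have the form `(u, c)` with `u` falling behind `c`. Then `w` also overtakes
      -- `u`, so `(w, u)` is a lost inversion. This map is injective and misses the lost inversion
      -- `(w, c)`, hence the number strictly decreases.
      have hsub : ((A' \ A).image fun q => (w, q.1)) ⊆ (A \ A').erase (w, c) := by
        intro q hq
        obtain ⟨⟨u, z⟩, hu, rfl⟩ := Finset.mem_image.1 hq
        obtain ⟨hu1, hu2⟩ := Finset.mem_sdiff.1 hu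
        have hz : z = c := by
          by_contra hz
          exact hu2 (hold hz hu1)
        subst hz
        have hu3 := (hmem u z).1 hu1
        have huc : u ≠ z := by rintro rfl; omega
        have hu4 : p u < p z := by
          rcases hne huc with h | h
          · exact h
          · exact absurd (mem_inversions.2 ⟨hu3.1, hu3.2.1, h⟩) hu2
        have hlt : p u < p w := hu4.trans hw
        have hlt' : p' w < p' u := hw'.trans hu3.2.2
        have hTT : T w < T u := by
          by_contra h
          exact absurd (hmono u w huc hwc (not_lt.1 h) hlt) hlt'.asymm
        simp only [Finset.mem_erase, Finset.mem_sdiff, ne_eq, Prod.mk.injEq, true_and]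
        refine ⟨huc, mem_inversions.2 ⟨hTT, hwL, hlt⟩, fun h => ?_⟩
        exact absurd ((hmem w u).1 h).2.2 hlt'.asymm
      have hinj : Set.InjOn (fun q : Fin C × Fin C => (w, q.1)) (A' \ A : Finset _) := by
        rintro ⟨u, z⟩ hu ⟨u', z'⟩ hu' h
        have hz {u z : Fin C} (hu : (u, z) ∈ A' \ A) : z = c := by
          obtain ⟨hu1, hu2⟩ := Finset.mem_sdiff.1 hu
          by_contra hz
          exact hu2 (hold hz hu1)
        have e1 := hz (Finset.mem_coe.1 hu)
        have e2 := hz (Finset.mem_coe.1 hu')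
        simp only [Prod.mk.injEq, true_and] at h
        rw [e1, e2, h]
      have hwmem : (w, c) ∈ A \ A' := by
        refine Finset.mem_sdiff.2 ⟨mem_inversions.2 ⟨by omega, hwL, hw⟩, fun h => ?_⟩
        exact absurd ((hmem w c).1 h).2.2 hw'.asymm
      calc (A' \ A).card = ((A' \ A).image fun q => (w, q.1)).card :=
            (Finset.card_image_of_injOn hinj).symm
        _ ≤ ((A \ A').erase (w, c)).card := Finset.card_le_card hsub
        _ < (A \ A').card := Finset.card_erase_lt_of_mem hwmem
    have h2 := Finset.card_sdiff_add_card_inter A A'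
    have h3 := Finset.card_sdiff_add_card_inter A' A
    rw [Finset.inter_comm] at h3
    omega
  push Not at hju
  have hju' {w : Fin C} (h : p' w < p' c) : p w < p c := by
    have hwc : w ≠ c := by rintro rfl; exact lt_irrefl _ h
    rcases hne hwc with h' | h'
    · exact h'
    · exact absurd h (not_lt.2 (hju w h'))
  -- Second case: nothing overtakes `c`, but `c` overtakes some `u`. The channel `e` that takes the
  -- old position of `c` is well-sampled by `hnext`; counting the channels ahead of `e` gives too
  -- many if `e` is behind `c`, and too few otherwise.
  by_cases hpa : ∃ u, p u < p c ∧ p' c < p' u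
  · exfalso
    obtain ⟨u, hu, hu'⟩ := hpa
    set e := p'.symm (p c) with he
    have hpe : p' e = p c := by simp [he]
    have hcard : (Finset.univ.filter fun z => p' z < p' e).card =
        (Finset.univ.filter fun z => p z < p c).card := by
      rw [card_filter_perm_lt, card_filter_perm_lt, hpe]
    have hTe : L ≤ T e := by
      rw [hT'] at hnext
      by_cases h : e = c
      · rwa [h]
      · rwa [Function.update_of_ne h] at hnext
    by_cases hec : p' c < p' e
    · have hpce : p c < p e := (hwell c e hc hTe).2 hec
      have hecne : e ≠ c := by rintro h; rw [h] at hec; exact lt_irrefl _ hec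
      refine absurd hcard (Finset.card_lt_card (Finset.ssubset_iff_subset_ne.2 ⟨?_, ?_⟩)).ne'
      · intro z hz
        simp only [Finset.mem_filter, Finset.mem_univ, true_and] at hz ⊢
        have hzc : z ≠ c := by rintro rfl; exact lt_irrefl _ hz
        by_cases hzL : L ≤ T z
        · exact ((hwell z c hzL hc).1 hz).trans hec
        · exact hmono z e hzc hecne (by omega) (hz.trans hpce)
      · intro h
        have : c ∈ Finset.univ.filter fun z => p' z < p' e := by simpa using hec
        rw [← h] at this
        simp at this
    · refine absurd hcard (Finset.card_lt_card (Finset.ssubset_iff_subset_ne.2 ⟨?_, ?_⟩)).ne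
      · intro z hz
        simp only [Finset.mem_filter, Finset.mem_univ, true_and] at hz ⊢
        exact hju' (hz.trans_le (not_lt.1 hec))
      · intro h
        have : u ∈ Finset.univ.filter fun z => p z < p c := by simpa using hu
        rw [← h] at this
        simp only [Finset.mem_filter, Finset.mem_univ, true_and] at this
        exact absurd (this.trans_le (not_lt.1 hec)) hu'.asymm
  push Not at hpa
  have hcw (w : Fin C) : p w < p c ↔ p' w < p' c := by
    refine ⟨fun h => ?_, hju'⟩
    have hwc : w ≠ c := by rintro rfl; exact lt_irrefl _ h
    rcases hne' hwc with h' | h'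
    · exact h'
    · exact absurd h' (not_lt.2 (hpa w h))
  have hcw' (w : Fin C) : p c < p w ↔ p' c < p' w := by
    by_cases hwc : w = c
    · simp [hwc]
    · have := hcw w
      rcases hne hwc with h | h <;> rcases hne' hwc with h' | h' <;>
        simp_all [not_lt.2, le_of_lt]
  have hsub : inversions L p' T' ⊆ inversions L p T := by
    rintro ⟨x, z⟩ h
    by_cases hz : z = c
    · subst hz
      have h' := (hmem x z).1 h
      exact mem_inversions.2 ⟨h'.1, h'.2.1, (hcw' x).2 h'.2.2⟩
    · exact hold hz h
  rcases hsub.eq_or_ssubset with heq | hss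
  · left
    -- Now `c` keeps its relative position, and any other pair that could be exchanged is an
    -- inversion; with no inversion lost, the ordering is unchanged.
    refine ⟨(perm_eq_of_lt_iff fun x z => ?_).symm, by rw [heq]⟩
    have half (x z : Fin C) (h : p x < p z) : p' x < p' z := by
      by_cases hx : x = c
      · subst hx; exact (hcw' z).1 h
      by_cases hz : z = c
      · subst hz; exact (hcw x).1 h
      by_cases hT : T x ≤ T z
      · exact hmono x z hx hz hT h
      by_cases hzL : L ≤ T z
      · exact (hwell x z (by omega) hzL).1 h
      have : (z, x) ∈ inversions L p T := mem_inversions.2 ⟨by omega, by omega, h⟩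
      rw [← heq] at this
      exact ((hmem z x).1 this).2.2
    refine ⟨half x z, fun h => ?_⟩
    have hxz : x ≠ z := by rintro rfl; exact lt_irrefl _ h
    rcases hne hxz with h' | h'
    · exact h'
    · exact absurd (half z x h') h.asymm
  · exact Or.inr (Finset.card_lt_card hss)

/-- A partial system of distinct representatives: the indices in `Y` are matched injectively,
away from the sets of the other indices, and `Y` contains the indices of all large sets. -/
theorem exists_partial_matching [NeZero C] (S : Fin U → Finset (Fin C)) :
    ∃ (Y : Finset (Fin U)) (a : Fin U → Fin C), (∀ y ∈ Y, a y ∈ S y) ∧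
      (∀ y ∈ Y, ∀ y' ∈ Y, a y = a y' → y = y') ∧ (∀ y ∈ Y, ∀ x ∉ Y, a y ∉ S x) ∧
      ∀ y, U ≤ (S y).card → y ∈ Y := by
  classical
  by_cases hall : ∀ X : Finset (Fin U), X.card ≤ (X.biUnion S).card
  · obtain ⟨a, ha, ha'⟩ := (Finset.all_card_le_biUnion_card_iff_exists_injective S).1 hall
    exact ⟨Finset.univ, a, fun y _ => ha' y, fun y _ y' _ h => ha h, by simp, by simp⟩
  push Not at hall
  obtain ⟨X₀, hX₀⟩ := hall
  -- `X` has the largest deficiency. Adding indices to `X` cannot increase it, which is Hall's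
  -- condition for the remaining indices once the values available to `X` are removed.
  obtain ⟨X, -, hX⟩ := Finset.exists_max_image (Finset.univ : Finset (Finset (Fin U)))
    (fun X => (X.card : ℤ) - (X.biUnion S).card) ⟨∅, by simp⟩
  have hXpos : (X.biUnion S).card < X.card := by
    have := hX X₀ (Finset.mem_univ _)
    omega
  have hmarriage (Z : Finset {y // y ∉ X}) :
      Z.card ≤ (Z.biUnion fun y => S y \ X.biUnion S).card := by
    set Z' : Finset (Fin U) := Z.map (Function.Embedding.subtype _) with hZ'
    have hdisj : Disjoint X Z' := by
      rw [Finset.disjoint_left]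
      intro y hy hy'
      obtain ⟨z, -, rfl⟩ := Finset.mem_map.1 hy'
      exact z.2 hy
    have h1 := hX (X ∪ Z') (Finset.mem_univ _)
    rw [Finset.card_union_of_disjoint hdisj] at h1
    have h2 : (X ∪ Z').biUnion S =
        X.biUnion S ∪ Z.biUnion fun y => S y \ X.biUnion S := by
      ext i
      simp only [hZ', Finset.mem_biUnion, Finset.mem_union, Finset.mem_map,
        Function.Embedding.coe_subtype, Finset.mem_sdiff]
      constructor
      · rintro ⟨y, hy | ⟨z, hz, rfl⟩, hi⟩
        · exact Or.inl ⟨y, hy, hi⟩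
        · by_cases h : ∃ x ∈ X, i ∈ S x
          · exact Or.inl h
          · exact Or.inr ⟨z, hz, hi, h⟩
      · rintro (⟨y, hy, hi⟩ | ⟨z, hz, hi, -⟩)
        · exact ⟨y, Or.inl hy, hi⟩
        · exact ⟨z, Or.inr ⟨z, hz, rfl⟩, hi⟩
    have h3 := Finset.card_union_le (X.biUnion S) (Z.biUnion fun y => S y \ X.biUnion S)
    rw [← h2] at h3
    have h4 : Z'.card = Z.card := Finset.card_map _
    push_cast at h1
    omega
  obtain ⟨a, ha, ha'⟩ := (Finset.all_card_le_biUnion_card_iff_exists_injective _).1 hmarriage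
  refine ⟨Finset.univ.filter (· ∉ X), fun y => if h : y ∉ X then a ⟨y, h⟩ else 0, ?_, ?_, ?_, ?_⟩
  · intro y hy
    have hy' : y ∉ X := by simpa using hy
    simp only [hy', not_false_eq_true, dite_true]
    exact (Finset.mem_sdiff.1 (ha' ⟨y, hy'⟩)).1
  · intro y hy z hz h
    have hy' : y ∉ X := by simpa using hy
    have hz' : z ∉ X := by simpa using hz
    simp only [hy', hz', not_false_eq_true, dite_true] at h
    exact congrArg Subtype.val (ha h)
  · intro y hy x hx h
    have hy' : y ∉ X := by simpa using hy
    have hx' : x ∈ X := by simpa using hx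
    simp only [hy', not_false_eq_true, dite_true] at h
    exact (Finset.mem_sdiff.1 (ha' ⟨y, hy'⟩)).2 (Finset.mem_biUnion.2 ⟨x, hx', h⟩)
  · intro y hy
    simp only [Finset.mem_filter, Finset.mem_univ, true_and]
    intro hyX
    -- A set with at least `U` elements cannot belong to `X`, because `X` has positive deficiency
    -- and at most `U` members.
    have h1 : (S y).card ≤ (X.biUnion S).card :=
      Finset.card_le_card (Finset.subset_biUnion_of_mem S hyX)
    have h2 : X.card ≤ U := by simpa using Finset.card_le_univ X
    omega

end Ordering

/-! ### Transitions of the user states and comparison of the indices. -/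

section Dynamics

variable {C U : ℕ}

open Classical in
/-- The transmission of user `j` collides. -/
noncomputable def hit (order : Fin U → Equiv.Perm (Fin C)) (m : ℕ) (s : Fin U → UserState C)
    (x : Slot C U) (j : Fin U) : Bool :=
  x.1 (channels order m s x j) && !decide (Sole (channels order m s x) j)

/-- The recorded collisions of user `j` including the present slot. -/
noncomputable def collNext (order : Fin U → Equiv.Perm (Fin C)) (m : ℕ) (s : Fin U → UserState C)
    (x : Slot C U) (j : Fin U) : Fin C → ℕ :=
  if hit order m s x j then Function.update (s j).coll (channels order m s x j)
    ((s j).coll (channels order m s x j) + 1) else (s j).coll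

/-- The collision count of user `j` exceeds its threshold. -/
def Exceeds (thr : ℕ → ℝ) (order : Fin U → Equiv.Perm (Fin C)) (m : ℕ)
    (s : Fin U → UserState C) (x : Slot C U) (j : Fin U) : Prop :=
  thr ((s j).est + 1) <
    (collisionCount ((s j).gMean m) (collNext order m s x j) (s j).est : ℝ)

section Step

variable (thr : ℕ → ℝ) (order : Fin U → Equiv.Perm (Fin C)) (m : ℕ) (s : Fin U → UserState C)
  (x : Slot C U) (j : Fin U)

lemma step_sensed : (step thr order m s x j).sensed =
    Function.update (s j).sensed (channels order m s x j)
      ((s j).sensed (channels order m s x j) + 1) := by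
  simp only [step, UserState.update]
  split_ifs <;> rfl

lemma step_free : (step thr order m s x j).free =
    if x.1 (channels order m s x j) then Function.update (s j).free (channels order m s x j)
      ((s j).free (channels order m s x j) + 1) else (s j).free := by
  simp only [step, UserState.update]
  split_ifs <;> rfl

variable {thr order m s x j}

lemma step_early (hm : m < C) : (step thr order m s x j).coll = (s j).coll ∧
    (step thr order m s x j).flag = (s j).flag ∧ (step thr order m s x j).rank = (s j).rank ∧
    (step thr order m s x j).est = (s j).est := by
  simp [step, UserState.update, hm]

lemma step_rank (hm : C ≤ m) : (step thr order m s x j).rank = (s j).nextRank (x.2 j) := by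
  simp only [step, UserState.update, hm.not_gt, if_false]
  split_ifs <;> rfl

lemma step_of_exceeds (hm : C ≤ m) (h : Exceeds thr order m s x j) :
    (step thr order m s x j).coll = (fun _ => 0) ∧ (step thr order m s x j).flag = false ∧
    (step thr order m s x j).est = raise (s j).est := by
  simp only [step, UserState.update, hm.not_gt, if_false]
  exact ⟨congrArg UserState.coll (if_pos h), congrArg UserState.flag (if_pos h),
    congrArg UserState.est (if_pos h)⟩

lemma step_of_not_exceeds (hm : C ≤ m) (h : ¬ Exceeds thr order m s x j) :
    (step thr order m s x j).coll = collNext order m s x j ∧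
    (step thr order m s x j).flag = hit order m s x j ∧
    (step thr order m s x j).est = (s j).est := by
  simp only [step, UserState.update, hm.not_gt, if_false]
  exact ⟨congrArg UserState.coll (if_neg h), congrArg UserState.flag (if_neg h),
    (congrArg UserState.est (if_neg h)).trans rfl⟩

lemma channels_eq (hm : C ≤ m) : channels order m s x j =
    sigma ((s j).gMean m) ((s j).nextRank (x.2 j)) := by
  simp [channels, UserState.nextChannel, hm.not_gt]

lemma le_est_raise (e : Fin C) : e ≤ raise e := by
  unfold raise
  split_ifs
  · exact Fin.le_def.2 (Nat.le_succ _)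
  · exact le_rfl

lemma nextRank_le (d : Draw C) {u : UserState C} (h : u.rank ≤ u.est) : u.nextRank d ≤ u.est := by
  unfold UserState.nextRank
  split_ifs
  · rw [Fin.le_def]
    exact Nat.lt_succ_iff.1 (d u.est).isLt
  · exact h

lemma step_est_le : (s j).est ≤ (step thr order m s x j).est := by
  rcases lt_or_ge m C with hm | hm
  · rw [(step_early hm).2.2.2]
  · by_cases h : Exceeds thr order m s x j
    · rw [(step_of_exceeds hm h).2.2]
      exact le_est_raise _
    · rw [(step_of_not_exceeds hm h).2.2]

lemma step_rank_le (h : (s j).rank ≤ (s j).est) :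
    (step thr order m s x j).rank ≤ (step thr order m s x j).est := by
  rcases lt_or_ge m C with hm | hm
  · rw [(step_early hm).2.2.2, (step_early hm).2.2.1]
    exact h
  · rw [step_rank hm]
    exact (nextRank_le _ h).trans step_est_le

lemma sensed_le_step (i : Fin C) : (s j).sensed i ≤ (step thr order m s x j).sensed i := by
  rw [step_sensed]
  by_cases h : i = channels order m s x j
  · subst h; simp
  · simp [h]

lemma sum_collNext : ∑ i, collNext order m s x j i =
    ∑ i, (s j).coll i + (if hit order m s x j then 1 else 0) := by
  unfold collNext
  split_ifs
  · rw [Finset.sum_update_of_mem (Finset.mem_univ _)]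
    have := Finset.add_sum_erase Finset.univ (s j).coll (Finset.mem_univ (channels order m s x j))
    rw [Finset.sdiff_singleton_eq_erase]
    omega
  · simp

lemma collisionCount_le (g : Fin C → ℝ) (coll : Fin C → ℕ) (e : Fin C) :
    collisionCount g coll e ≤ ∑ i, coll i := by
  unfold collisionCount
  rw [← Equiv.sum_comp (sigma g) coll]
  exact Finset.sum_le_sum_of_subset (Finset.subset_univ _)

end Step

section States

variable [NeZero C] {thr : ℕ → ℝ} {order : Fin U → Equiv.Perm (Fin C)}

variable (thr order) in
lemma dependsOn_states {t m : ℕ} (htm : t ≤ m) :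
    DependsOn (fun ω => states thr order ω t) (Set.Iio m) := by
  intro ω ω' h
  induction t with
  | zero => rfl
  | succ t ih =>
    have := ih (by omega)
    simp only [states] at this ⊢
    rw [this, h t htm]

lemma states_early (ω : ℕ → Slot C U) {m : ℕ} (hm : m ≤ C) (j : Fin U) :
    (states thr order ω m j).coll = (fun _ => 0) ∧ (states thr order ω m j).flag = false ∧
    (states thr order ω m j).est = 0 := by
  induction m with
  | zero => exact ⟨rfl, rfl, rfl⟩
  | succ m ih =>
    obtain ⟨h1, h2, h3⟩ := ih (by omega)
    obtain ⟨k1, k2, -, k4⟩ := step_early (thr := thr) (order := order)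
      (s := states thr order ω m) (x := ω m) (j := j) (show m < C by omega)
    exact ⟨k1.trans h1, k2.trans h2, k4.trans h3⟩

lemma rank_le_est (ω : ℕ → Slot C U) (m : ℕ) (j : Fin U) :
    (states thr order ω m j).rank ≤ (states thr order ω m j).est := by
  induction m with
  | zero => exact le_rfl
  | succ m ih => exact step_rank_le ih

lemma sensed_le (ω : ℕ → Slot C U) (m : ℕ) (j : Fin U) (i : Fin C) :
    (states thr order ω m j).sensed i ≤ m := by
  induction m with
  | zero => exact le_rfl
  | succ m ih =>
    rw [states, step_sensed]
    by_cases h : i = channels order m (states thr order ω m) (ω m) j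
    · subst h; simpa using ih
    · simp only [Function.update_of_ne h]; omega

lemma sensed_mono (ω : ℕ → Slot C U) (j : Fin U) (i : Fin C) :
    Monotone fun m => (states thr order ω m j).sensed i :=
  monotone_nat_of_le_succ fun _ => sensed_le_step i

lemma sensed_pos (ω : ℕ → Slot C U) {m : ℕ} (hm : C ≤ m) (j : Fin U) (i : Fin C) :
    1 ≤ (states thr order ω m j).sensed i := by
  set t : Fin C := (order j).symm i with ht
  have h1 : channels order t (states thr order ω t) (ω t) j = i := by
    simp [channels, UserState.nextChannel, ht]
  have h2 : 1 ≤ (states thr order ω (t + 1) j).sensed i := by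
    rw [states, step_sensed, h1]
    simp
  exact h2.trans (sensed_mono ω j i (show (t : ℕ) + 1 ≤ m from t.isLt.trans_le hm))

end States

section Indices

lemma sqrt_index_le {L T m : ℕ} {ε : ℝ} (hε : 0 ≤ ε) (hL : 0 < L) (hLT : L ≤ T)
    (hm : 2 * Real.log m ≤ ε ^ 2 * L) : √(2 * Real.log m / T) ≤ ε := by
  have hT : (0 : ℝ) < T := by exact_mod_cast hL.trans_le hLT
  refine Real.sqrt_le_iff.2 ⟨hε, ?_⟩
  rw [div_le_iff₀ hT]
  have : (L : ℝ) ≤ T := by exact_mod_cast hLT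
  nlinarith [sq_nonneg ε]

/-- Only the confidence terms move, and the difference of the two indices grows by `(√(2 log (m +
1)) - √(2 log m)) * (1 / √T x - 1 / √T z) ≥ 0`, where `T` is the sample count. -/
lemma sigma_symm_mono {s s' : UserState C} {m : ℕ} {x z : Fin C}
    (hx : 1 ≤ s.sensed x) (hxz : s.sensed x ≤ s.sensed z)
    (hx1 : s'.sensed x = s.sensed x) (hz1 : s'.sensed z = s.sensed z)
    (hx2 : s'.free x = s.free x) (hz2 : s'.free z = s.free z)
    (h : (sigma (s.gMean m)).symm x < (sigma (s.gMean m)).symm z) :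
    (sigma (s'.gMean (m + 1))).symm x < (sigma (s'.gMean (m + 1))).symm z := by
  rw [sigma_symm_lt_iff] at h ⊢
  have hlog : Real.log m ≤ Real.log ((m + 1 : ℕ) : ℝ) := by
    rcases Nat.eq_zero_or_pos m with h0 | h0
    · simp [h0]
    · refine Real.log_le_log (by exact_mod_cast h0) ?_
      push_cast; linarith
  have h0 : 0 ≤ Real.log m := Real.log_natCast_nonneg m
  have hA : √(2 * Real.log m) ≤ √(2 * Real.log ((m + 1 : ℕ) : ℝ)) :=
    Real.sqrt_le_sqrt (by linarith)
  have hTx : (0 : ℝ) < s.sensed x := by exact_mod_cast hx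
  have hT : (s.sensed x : ℝ) ≤ s.sensed z := by exact_mod_cast hxz
  have hu : (√(s.sensed z : ℝ))⁻¹ ≤ (√(s.sensed x : ℝ))⁻¹ :=
    inv_anti₀ (Real.sqrt_pos.2 hTx) (Real.sqrt_le_sqrt hT)
  have key : s.gMean m x - s.gMean m z ≤ s'.gMean (m + 1) x - s'.gMean (m + 1) z := by
    simp only [UserState.gMean, hx1, hz1, hx2, hz2]
    rw [Real.sqrt_div (by positivity), Real.sqrt_div (by positivity),
      Real.sqrt_div (by linarith), Real.sqrt_div (by linarith)]
    simp only [div_eq_mul_inv (√_) (√_)]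
    nlinarith
  rcases h with h | h
  · left; linarith
  · rcases (show s'.gMean (m + 1) z ≤ s'.gMean (m + 1) x by linarith [h.1]).lt_or_eq with h' | h'
    · exact Or.inl h'
    · exact Or.inr ⟨h'.symm, h.2⟩

/-- The sample means of all channels sensed at least `L` times are `ε`-close to the means. -/
def Accurate (μ : Fin C → I) (L : ℕ) (ε : ℝ) (s : Fin U → UserState C) : Prop :=
  ∀ j i, L ≤ (s j).sensed i → |((s j).free i : ℝ) / (s j).sensed i - μ i| ≤ ε

variable {μ : Fin C → I} {L : ℕ} {ε : ℝ} {s : Fin U → UserState C} {m : ℕ}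

lemma Accurate.gMean_mem (h : Accurate μ L ε s) (hε : 0 ≤ ε) (hL : 0 < L)
    (hm : 2 * Real.log m ≤ ε ^ 2 * L) {j : Fin U} {i : Fin C} (hi : L ≤ (s j).sensed i) :
    μ i - ε ≤ (s j).gMean m i ∧ (s j).gMean m i ≤ μ i + 2 * ε := by
  have h1 := abs_le.1 (h j i hi)
  have h2 := sqrt_index_le hε hL hi hm
  have h3 := Real.sqrt_nonneg (2 * Real.log m / (s j).sensed i)
  unfold UserState.gMean
  constructor <;> linarith

/-- Indices of well-sampled channels lie in `[μ - ε, μ + 2ε]`, and a gap of `4ε` makes these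
intervals disjoint, so ties do not matter. -/
lemma Accurate.sigma_symm_lt_iff (h : Accurate μ L ε s) (hε : 0 < ε) (hL : 0 < L)
    (hm : 2 * Real.log m ≤ ε ^ 2 * L)
    (hgap : ∀ i i', μ i < μ i' → (μ i : ℝ) + 4 * ε ≤ μ i') (hinj : Function.Injective μ)
    {j : Fin U} {x z : Fin C} (hx : L ≤ (s j).sensed x) (hz : L ≤ (s j).sensed z) :
    (sigma ((s j).gMean m)).symm x < (sigma ((s j).gMean m)).symm z ↔ μ z < μ x := by
  rw [CognitiveRadio.sigma_symm_lt_iff]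
  have h1 := h.gMean_mem hε.le hL hm hx
  have h2 := h.gMean_mem hε.le hL hm hz
  by_cases hxz : x = z
  · simp [hxz]
  rcases lt_or_gt_of_ne (hinj.ne hxz) with h3 | h3
  · have := hgap _ _ h3
    refine ⟨fun h => ?_, fun h => absurd h h3.asymm⟩
    rcases h with h | h
    · linarith
    · linarith [h.1]
  · have := hgap _ _ h3
    exact ⟨fun _ => h3, fun _ => Or.inl (by linarith)⟩

end Indices

end Dynamics

/-! ### Budget, inversions and settlers: the ingredients of the potential. -/

section Potential

variable {C U : ℕ}

/-- A user whose estimate is correct exceeds its threshold. -/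
def Trigger (thr : ℕ → ℝ) (order : Fin U → Equiv.Perm (Fin C)) (m : ℕ)
    (s : Fin U → UserState C) (x : Slot C U) : Prop :=
  C ≤ m ∧ ∃ j, ((s j).est : ℕ) + 1 = U ∧ Exceeds thr order m s x j

/-- The number of times a channel was sensed that was not yet sensed `L` times, plus the sum of the
estimates. -/
def budget (L : ℕ) (s : Fin U → UserState C) : ℕ :=
  ∑ j, (∑ i, min ((s j).sensed i) L + ((s j).est : ℕ))

/-- The total number of inversions of all users. -/
noncomputable def invCount (L m : ℕ) (s : Fin U → UserState C) : ℕ :=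
  ∑ j, (inversions L (sigma ((s j).gMean m)).symm (s j).sensed).card

/-- The channel at the rank of some user has been sensed less than `L` times by that user. -/
def Pending (L m : ℕ) (s : Fin U → UserState C) : Prop :=
  ∃ j, (s j).sensed (sigma ((s j).gMean m) (s j).rank) < L

/-- The channels which the users consider to be the best ones, as many as their estimates say. -/
noncomputable def window (m : ℕ) (s : Fin U → UserState C) (j : Fin U) : Finset (Fin C) :=
  (Finset.Iic (s j).est).image (sigma ((s j).gMean m))

/-- The users that can be separated from each other and from the other users. -/
noncomputable def settlers [NeZero C] (S : Fin U → Finset (Fin C)) : Finset (Fin U) :=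
  (exists_partial_matching S).choose

/-- The channels on which the users in `settlers S` do not meet any user. -/
noncomputable def goal [NeZero C] (S : Fin U → Finset (Fin C)) : Fin U → Fin C :=
  (exists_partial_matching S).choose_spec.choose

lemma goal_spec [NeZero C] (S : Fin U → Finset (Fin C)) :
    (∀ y ∈ settlers S, goal S y ∈ S y) ∧
      (∀ y ∈ settlers S, ∀ y' ∈ settlers S, goal S y = goal S y' → y = y') ∧
      (∀ y ∈ settlers S, ∀ x ∉ settlers S, goal S y ∉ S x) ∧
      ∀ y, U ≤ (S y).card → y ∈ settlers S :=
  (exists_partial_matching S).choose_spec.choose_spec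

/-- The settlers that are not at their goal. -/
noncomputable def offGoal [NeZero C] (m : ℕ) (s : Fin U → UserState C) : Finset (Fin U) :=
  (settlers (window m s)).filter fun j =>
    sigma ((s j).gMean m) (s j).rank ≠ goal (window m s) j

/-- The settlers that draw a new rank in the next slot. -/
noncomputable def flagged [NeZero C] (m : ℕ) (s : Fin U → UserState C) : Finset (Fin U) :=
  (settlers (window m s)).filter fun j => (s j).flag = true

section Quiet

variable {thr : ℕ → ℝ} {order : Fin U → Equiv.Perm (Fin C)} {m L : ℕ} {s : Fin U → UserState C}
  {x : Slot C U}

lemma userBudget_le_step (j : Fin U) : ∑ i, min ((s j).sensed i) L + ((s j).est : ℕ) ≤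
    ∑ i, min ((step thr order m s x j).sensed i) L + ((step thr order m s x j).est : ℕ) :=
  add_le_add (Finset.sum_le_sum fun i _ => min_le_min_right L (sensed_le_step i)) step_est_le

lemma budget_le_step : budget L s ≤ budget L (step thr order m s x) :=
  Finset.sum_le_sum fun j _ => userBudget_le_step j

lemma budget_lt_of_sensed {j : Fin U} (h : (s j).sensed (channels order m s x j) < L) :
    budget L s < budget L (step thr order m s x) := by
  refine Finset.sum_lt_sum (fun j _ => userBudget_le_step j) ⟨j, Finset.mem_univ _, ?_⟩
  refine add_lt_add_of_lt_of_le (Finset.sum_lt_sum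
    (fun i _ => min_le_min_right L (sensed_le_step i))
    ⟨channels order m s x j, Finset.mem_univ _, ?_⟩) step_est_le
  rw [step_sensed, Function.update_self]
  omega

/-- The bound `hj` is needed because `raise` saturates at `C`. -/
lemma budget_lt_of_exceeds (hm : C ≤ m) {j : Fin U} (h : Exceeds thr order m s x j)
    (hj : ((s j).est : ℕ) + 1 < C) : budget L s < budget L (step thr order m s x) := by
  refine Finset.sum_lt_sum (fun j _ => userBudget_le_step j) ⟨j, Finset.mem_univ _, ?_⟩
  refine add_lt_add_of_le_of_lt (Finset.sum_le_sum
    (fun i _ => min_le_min_right L (sensed_le_step i))) ?_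
  rw [(step_of_exceeds hm h).2.2, raise, dif_pos hj]
  exact Nat.lt_succ_self _

lemma budget_le (s : Fin U → UserState C) : budget L s ≤ U * (C * L + C) := by
  calc budget L s ≤ ∑ _j : Fin U, (∑ _i : Fin C, L + C) :=
        Finset.sum_le_sum fun j _ => add_le_add (Finset.sum_le_sum fun i _ => min_le_right _ _)
          (s j).est.isLt.le
    _ = _ := by simp

lemma invCount_le (s : Fin U → UserState C) : invCount L m s ≤ U * C ^ 2 := by
  calc invCount L m s ≤ ∑ _j : Fin U, C ^ 2 := Finset.sum_le_sum fun j _ => by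
        refine (Finset.card_le_univ _).trans ?_
        simp [sq]
    _ = _ := by simp

lemma hit_iff {j : Fin U} : hit order m s x j = true ↔
    x.1 (channels order m s x j) = true ∧
      ∃ j', j' ≠ j ∧ channels order m s x j' = channels order m s x j := by
  rw [hit, Bool.and_eq_true, Bool.not_eq_true', decide_eq_false_iff_not]
  unfold Sole
  push Not
  rfl

/-- Without a change of the budget, either the ordering of the channels stays the same for every
user, or the number of inversions decreases. -/
lemma quiet_step {μ : Fin C → I} {ε : ℝ} (hε : 0 < ε) (hL : 0 < L)
    (hgap : ∀ i i', μ i < μ i' → (μ i : ℝ) + 4 * ε ≤ μ i') (hinj : Function.Injective μ)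
    (hm : C ≤ m) (hest : ∀ j, ((s j).est : ℕ) + 1 ≤ U) (hUC : U ≤ C)
    (hpos : ∀ j i, 1 ≤ (s j).sensed i)
    (hacc : Accurate μ L ε s) (hacc' : Accurate μ L ε (step thr order m s x))
    (hlog : 2 * Real.log ((m + 1 : ℕ) : ℝ) ≤ ε ^ 2 * L) (htrig : ¬ Trigger thr order m s x)
    (hbud : ¬ budget L s < budget L (step thr order m s x))
    (hpend : ¬ Pending L (m + 1) (step thr order m s x)) :
    (∀ j, ¬ Exceeds thr order m s x j) ∧
      (invCount L (m + 1) (step thr order m s x) < invCount L m s ∨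
        (invCount L (m + 1) (step thr order m s x) = invCount L m s ∧
          ∀ j, sigma ((step thr order m s x j).gMean (m + 1)) = sigma ((s j).gMean m))) := by
  have hlog' : 2 * Real.log (m : ℝ) ≤ ε ^ 2 * L := by
    refine le_trans ?_ hlog
    rcases Nat.eq_zero_or_pos m with h0 | h0
    · simp [h0]
    · have : Real.log m ≤ Real.log ((m + 1 : ℕ) : ℝ) :=
        Real.log_le_log (by exact_mod_cast h0) (by push_cast; linarith)
      linarith
  refine ⟨fun j hj => ?_, ?_⟩
  -- Exceeding a threshold below estimate `U` spends budget; at estimate `U` it is a `Trigger`.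
  · rcases (hest j).lt_or_eq with h | h
    · exact hbud (budget_lt_of_exceeds hm hj (h.trans_le hUC))
    · exact htrig ⟨hm, j, h, hj⟩
  have hwell (j : Fin U) : L ≤ (s j).sensed (channels order m s x j) := by
    by_contra h
    exact hbud (budget_lt_of_sensed (not_le.1 h))
  have key (j : Fin U) := by
    refine ordering_dichotomy (p := (sigma ((s j).gMean m)).symm)
      (p' := (sigma ((step thr order m s x j).gMean (m + 1))).symm) (hwell j)
      (step_sensed thr order m s x j) ?_ ?_ ?_
    · intro y z hy hz hyz h
      refine sigma_symm_mono (hpos j y) hyz ?_ ?_ ?_ ?_ h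
      · rw [step_sensed, Function.update_of_ne hy]
      · rw [step_sensed, Function.update_of_ne hz]
      · rw [step_free]; split_ifs
        · rw [Function.update_of_ne hy]
        · rfl
      · rw [step_free]; split_ifs
        · rw [Function.update_of_ne hz]
        · rfl
    · intro y z hy hz
      rw [hacc.sigma_symm_lt_iff hε hL hlog' hgap hinj hy hz,
        hacc'.sigma_symm_lt_iff hε hL hlog hgap hinj (hy.trans (sensed_le_step y))
          (hz.trans (sensed_le_step z))]
    -- The old position of the sensed channel is the rank now stored, so the channel taking that
    -- position is well-sampled unless the new state is pending.
    · rw [channels_eq hm, Equiv.symm_apply_apply, Equiv.symm_symm, ← step_rank (thr := thr)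
        (order := order) hm]
      by_contra h
      exact hpend ⟨j, not_le.1 h⟩
  by_cases hall : ∀ j, sigma ((step thr order m s x j).gMean (m + 1)) = sigma ((s j).gMean m) ∧
      (inversions L (sigma ((step thr order m s x j).gMean (m + 1))).symm
        (step thr order m s x j).sensed).card =
      (inversions L (sigma ((s j).gMean m)).symm (s j).sensed).card
  · exact Or.inr ⟨Finset.sum_congr rfl fun j _ => (hall j).2, fun j => (hall j).1⟩
  · left
    push Not at hall
    obtain ⟨j, hj⟩ := hall
    refine Finset.sum_lt_sum (fun j _ => ?_) ⟨j, Finset.mem_univ _, ?_⟩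
    · rcases key j with h | h
      · exact h.2.le
      · exact h.le
    · rcases key j with h | h
      · have h1 := congrArg Equiv.symm h.1
        exact absurd h.2 (hj (by simpa only [Equiv.symm_symm] using h1))
      · exact h

lemma window_eq (hm : C ≤ m) (hex : ∀ j, ¬ Exceeds thr order m s x j)
    (hsig : ∀ j, sigma ((step thr order m s x j).gMean (m + 1)) = sigma ((s j).gMean m)) :
    window (m + 1) (step thr order m s x) = window m s := by
  funext j
  rw [window, window, hsig, (step_of_not_exceeds hm (hex j)).2.2]

variable [NeZero C]

/-- If the orderings and estimates do not change, then some settler that collides is not at its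
goal. -/
lemma exists_flagged_offGoal (hm : C ≤ m) (hrank : ∀ j, (s j).rank ≤ (s j).est)
    (hex : ∀ j, ¬ Exceeds thr order m s x j)
    (hsig : ∀ j, sigma ((step thr order m s x j).gMean (m + 1)) = sigma ((s j).gMean m))
    (h : (flagged (m + 1) (step thr order m s x)).Nonempty) :
    ∃ j ∈ flagged (m + 1) (step thr order m s x), j ∈ offGoal (m + 1) (step thr order m s x) := by
  obtain ⟨j, hj⟩ := h
  set s' := step thr order m s x with hs'
  set Y := settlers (window (m + 1) s') with hY
  have hch (j : Fin U) : sigma ((s' j).gMean (m + 1)) (s' j).rank = channels order m s x j := by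
    rw [hsig, channels_eq hm, hs', step_rank hm]
  have hwin (j : Fin U) : channels order m s x j ∈ window (m + 1) s' j := by
    rw [← hch j]
    exact Finset.mem_image_of_mem _ (Finset.mem_Iic.2 (step_rank_le (hrank j)))
  have hfl (j : Fin U) : (s' j).flag = hit order m s x j := (step_of_not_exceeds hm (hex j)).2.1
  obtain ⟨-, hinj, hout, -⟩ := goal_spec (window (m + 1) s')
  simp only [flagged, Finset.mem_filter, hfl] at hj
  obtain ⟨hjY, hjhit⟩ := hj
  obtain ⟨hfree, j', hne, hsame⟩ := hit_iff.1 hjhit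
  have hj'hit : hit order m s x j' = true := hit_iff.2 ⟨by rw [hsame]; exact hfree, j, hne.symm,
    hsame.symm⟩
  simp only [flagged, offGoal, Finset.mem_filter, hfl, hch]
  by_contra hcon
  push Not at hcon
  have h1 := hcon j ⟨hjY, hjhit⟩ hjY
  -- Suppose all colliding settlers are at their goals. The partner `j'` collides too: as a settler
  -- it would have the same goal as `j`, and otherwise its window would contain that goal.
  by_cases hj'Y : j' ∈ Y
  · have h2 := hcon j' ⟨hj'Y, hj'hit⟩ hj'Y
    exact hne (hinj j' hj'Y j hjY (by rw [← h1, ← h2, hsame]))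
  · refine hout j hjY j' hj'Y ?_
    rw [← h1, ← hsame]
    exact hwin j'

/-- Settlers that do not redraw keep their rank and hence their channel; those that redraw land on
their goals. -/
lemma mem_offGoal_of_step (hm : C ≤ m) (hex : ∀ j, ¬ Exceeds thr order m s x j)
    (hsig : ∀ j, sigma ((step thr order m s x j).gMean (m + 1)) = sigma ((s j).gMean m))
    (hdraw : ∀ j ∈ flagged m s, sigma ((s j).gMean m) ((s j).nextRank (x.2 j)) =
      goal (window m s) j) :
    offGoal (m + 1) (step thr order m s x) ⊆ offGoal m s \ flagged m s := by
  intro j hj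
  simp only [offGoal, Finset.mem_filter, window_eq hm hex hsig, hsig, step_rank hm] at hj
  have hjf : j ∉ flagged m s := fun h => hj.2 (hdraw j h)
  refine Finset.mem_sdiff.2 ⟨Finset.mem_filter.2 ⟨hj.1, ?_⟩, hjf⟩
  have : (s j).flag = false := by
    by_contra h
    exact hjf (Finset.mem_filter.2 ⟨hj.1, by simpa using h⟩)
  have h2 := hj.2
  rwa [UserState.nextRank, this, if_neg (by simp)] at h2

end Quiet

end Potential

/-! ### The potential decreases in relevant slots. -/

section Overestimation

variable {C U : ℕ} [NeZero C]

section Defs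

variable (thr : ℕ → ℝ) (order : Fin U → Equiv.Perm (Fin C)) (μ : Fin C → I) (L : ℕ) (ε : ℝ)

/-- Up to slot `m`, no user with a correct estimate has exceeded its threshold, and all sample means
have been accurate. -/
def Alive (m : ℕ) (ω : ℕ → Slot C U) : Prop :=
  (∀ t < m, ¬ Trigger thr order t (states thr order ω t) (ω t)) ∧
    (∀ t ≤ m, Accurate μ L ε (states thr order ω t)) ∧ 2 * Real.log m ≤ ε ^ 2 * L

/-- The slots in which settlers draw new ranks, or in which a user is about to sense a channel that
it has not yet sensed `L` times. -/
def Relevant (m : ℕ) (ω : ℕ → Slot C U) : Prop :=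
  C ≤ m ∧ Alive thr order μ L ε m ω ∧
    (Pending L m (states thr order ω m) ∨ (flagged m (states thr order ω m)).Nonempty)

open Classical in
/-- The number of relevant slots before slot `m`. -/
noncomputable def relevantCount (m : ℕ) (ω : ℕ → Slot C U) : ℕ :=
  ((Finset.range m).filter fun t => Relevant thr order μ L ε t ω).card

/-- The largest value of the potential. -/
def potentialBound (C U : ℕ) : ℕ := (U + 2) * (U * C ^ 2) + (U + 1)

open Classical in
/-- The potential of the settlers that are not at their goals; a change of the ordering of the
channels, which changes the goals, comes with a smaller number of inversions. -/
noncomputable def potential (m : ℕ) (ω : ℕ → Slot C U) : ℕ :=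
  -- The start-up value is maximal so that the potential cannot rise there. In a pending state it is
  -- `0`, since progress then comes from the budget alone.
  if m < C then potentialBound C U
  else if ¬ Alive thr order μ L ε m ω ∨ Pending L m (states thr order ω m) then 0
  else (U + 2) * invCount L m (states thr order ω m) +
    -- If all redrawing settlers already sit at their goals, a successful redraw does not shrink
    -- `offGoal`. The value `U + 1` exceeds every possible `offGoal` count, so the next slot can
    -- still show a decrease.
    if (flagged m (states thr order ω m)).Nonempty ∧
      Disjoint (flagged m (states thr order ω m)) (offGoal m (states thr order ω m)) then U + 1
    else (offGoal m (states thr order ω m)).card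

end Defs

variable {thr : ℕ → ℝ} {order : Fin U → Equiv.Perm (Fin C)} {μ : Fin C → I} {L : ℕ} {ε : ℝ}

lemma Alive.mono {m t : ℕ} (htm : t ≤ m) {ω : ℕ → Slot C U} (h : Alive thr order μ L ε m ω) :
    Alive thr order μ L ε t ω := by
  refine ⟨fun u hu => h.1 u (hu.trans_le htm), fun u hu => h.2.1 u (hu.trans htm),
    le_trans ?_ h.2.2⟩
  rcases Nat.eq_zero_or_pos t with h0 | h0
  · simpa [h0] using Real.log_natCast_nonneg m
  · have : Real.log t ≤ Real.log m :=
      Real.log_le_log (by exact_mod_cast h0) (by exact_mod_cast htm)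
    linarith

lemma dependsOn_alive {t m : ℕ} (htm : t ≤ m) :
    DependsOn (Alive thr order μ L ε t) (Set.Iio m) := by
  intro ω ω' h
  have hs (u : ℕ) (hu : u ≤ t) : states thr order ω u = states thr order ω' u :=
    dependsOn_states thr order (hu.trans htm) h
  simp only [Alive, eq_iff_iff]
  refine and_congr (forall₂_congr fun u hu => ?_) (and_congr_left' (forall₂_congr fun u hu => ?_))
  · rw [hs u hu.le, h u (hu.trans_le htm)]
  · rw [hs u hu]

lemma dependsOn_relevant {t m : ℕ} (htm : t ≤ m) :
    DependsOn (Relevant thr order μ L ε t) (Set.Iio m) := by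
  intro ω ω' h
  have hs : states thr order ω t = states thr order ω' t := dependsOn_states thr order htm h
  simp only [Relevant, hs, dependsOn_alive htm h]

lemma dependsOn_relevantCount (m : ℕ) :
    DependsOn (relevantCount thr order μ L ε m) (Set.Iio m) := by
  intro ω ω' h
  classical
  refine congrArg Finset.card (Finset.filter_congr fun t ht => ?_)
  rw [dependsOn_relevant (Finset.mem_range.1 ht).le h]

lemma dependsOn_potential (m : ℕ) : DependsOn (potential thr order μ L ε m) (Set.Iio m) := by
  intro ω ω' h
  have hs : states thr order ω m = states thr order ω' m := dependsOn_states thr order le_rfl h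
  have ha : Alive thr order μ L ε m ω = Alive thr order μ L ε m ω' := dependsOn_alive le_rfl h
  unfold potential
  rw [hs, ha]

lemma relevantCount_succ_of_relevant {m : ℕ} {ω : ℕ → Slot C U}
    (h : Relevant thr order μ L ε m ω) :
    relevantCount thr order μ L ε (m + 1) ω = relevantCount thr order μ L ε m ω + 1 := by
  rw [relevantCount, Finset.range_add_one, Finset.filter_insert, if_pos h,
    Finset.card_insert_of_notMem (by simp), relevantCount]

lemma relevantCount_succ_of_not_relevant {m : ℕ} {ω : ℕ → Slot C U}
    (h : ¬ Relevant thr order μ L ε m ω) :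
    relevantCount thr order μ L ε (m + 1) ω = relevantCount thr order μ L ε m ω := by
  rw [relevantCount, Finset.range_add_one, Finset.filter_insert, if_neg h, relevantCount]

lemma relevantCount_mono (ω : ℕ → Slot C U) :
    Monotone fun m => relevantCount thr order μ L ε m ω := fun m n h => by
  classical
  exact Finset.card_le_card (Finset.filter_subset_filter _ (Finset.range_mono h))

lemma card_offGoal_le (m : ℕ) (s : Fin U → UserState C) : (offGoal m s).card ≤ U := by
  simpa using Finset.card_le_univ (offGoal m s)

lemma potential_le (m : ℕ) (ω : ℕ → Slot C U) :
    potential thr order μ L ε m ω ≤ potentialBound C U := by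
  unfold potential potentialBound
  have h1 := invCount_le (L := L) (m := m) (states thr order ω m)
  have h2 := card_offGoal_le m (states thr order ω m)
  split_ifs
  · exact le_rfl
  · exact Nat.zero_le _
  · gcongr
  · gcongr; omega

lemma Alive.est_lt {m : ℕ} {ω : ℕ → Slot C U} (hU : 1 ≤ U) (h : Alive thr order μ L ε m ω)
    (j : Fin U) : ((states thr order ω m j).est : ℕ) + 1 ≤ U := by
  induction m with
  | zero => simpa [states, UserState.initial] using hU
  | succ m ih =>
    have h1 := ih (h.mono (Nat.le_succ m))
    rcases lt_or_ge m C with hm | hm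
    · rw [states, (step_early hm).2.2.2]; exact h1
    · by_cases he : Exceeds thr order m (states thr order ω m) (ω m) j
      · rw [states, (step_of_exceeds hm he).2.2]
        have h2 : ((states thr order ω m j).est : ℕ) + 1 ≠ U := fun h2 =>
          h.1 m (Nat.lt_succ_self m) ⟨hm, j, h2, he⟩
        unfold raise
        split_ifs
        · simp only; omega
        · exact h1
      · rw [states, (step_of_not_exceeds hm he).2.2]; exact h1

/-- Outside pending states, the potential goes down in every slot after which nothing is pending,
as soon as all settlers that draw new ranks draw their goals. -/
lemma potential_step (hU : 1 ≤ U) (hUC : U ≤ C) (hε : 0 < ε) (hL : 0 < L)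
    (hgap : ∀ i i', μ i < μ i' → (μ i : ℝ) + 4 * ε ≤ μ i') (hinj : Function.Injective μ)
    {m : ℕ} {ω : ℕ → Slot C U} (hm : C ≤ m) (ha : Alive thr order μ L ε m ω)
    (hp : ¬ Pending L m (states thr order ω m))
    (hdraw : ∀ j ∈ flagged m (states thr order ω m),
      sigma ((states thr order ω m j).gMean m) ((states thr order ω m j).nextRank ((ω m).2 j)) =
        goal (window m (states thr order ω m)) j) :
    budget L (states thr order ω m) < budget L (states thr order ω (m + 1)) ∨
      potential thr order μ L ε (m + 1) ω +
        (if (flagged m (states thr order ω m)).Nonempty then 1 else 0) ≤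
          potential thr order μ L ε m ω := by
  classical
  set s := states thr order ω m with hs
  have hs' : states thr order ω (m + 1) = step thr order m s (ω m) := rfl
  refine or_iff_not_imp_left.2 fun hbud => ?_
  have hΦ : potential thr order μ L ε m ω = (U + 2) * invCount L m s +
      if (flagged m s).Nonempty ∧ Disjoint (flagged m s) (offGoal m s) then U + 1
      else (offGoal m s).card := by
    rw [potential, if_neg hm.not_gt, if_neg (not_or.2 ⟨not_not.2 ha, hp⟩)]
  -- Covers a dead or pending successor, whose potential is `0`: a state with redrawing settlers has
  -- positive potential.
  have hge : (if (flagged m s).Nonempty then 1 else 0) ≤ potential thr order μ L ε m ω := by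
    rw [hΦ]
    split_ifs with h1 h2 h2
    · omega
    · have : (offGoal m s).Nonempty := by
        by_contra h3
        rw [Finset.not_nonempty_iff_eq_empty] at h3
        exact h2 ⟨h1, by simp [h3]⟩
      have := this.card_pos
      omega
    · omega
    · omega
  by_cases hdead : ¬ Alive thr order μ L ε (m + 1) ω ∨ Pending L (m + 1) (states thr order ω (m + 1))
  · rw [potential, if_neg (by omega), if_pos hdead]
    simpa using hge
  have hΦ' : potential thr order μ L ε (m + 1) ω =
      (U + 2) * invCount L (m + 1) (step thr order m s (ω m)) +
      if (flagged (m + 1) (step thr order m s (ω m))).Nonempty ∧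
        Disjoint (flagged (m + 1) (step thr order m s (ω m)))
          (offGoal (m + 1) (step thr order m s (ω m))) then U + 1
      else (offGoal (m + 1) (step thr order m s (ω m))).card := by
    rw [potential, if_neg (by omega), if_neg hdead, hs']
  push Not at hdead
  obtain ⟨ha', hp'⟩ := hdead
  obtain ⟨hex, hcase⟩ := quiet_step (s := s) (x := ω m) hε hL hgap hinj hm (ha.est_lt hU) hUC
    (fun j i => sensed_pos ω hm j i) (ha.2.1 m le_rfl) (ha'.2.1 (m + 1) le_rfl) ha'.2.2
    (ha'.1 m (Nat.lt_succ_self m)) hbud hp'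
  have hoff := card_offGoal_le (m + 1) (step thr order m s (ω m))
  rcases hcase with hlt | ⟨heq, hsig⟩
  -- A lost inversion, worth `U + 2`, pays for the largest second term `U + 1` and one more.
  · have h1 : potential thr order μ L ε (m + 1) ω + 1 ≤ (U + 2) * invCount L m s := by
      rw [hΦ']
      have : (U + 2) * (invCount L (m + 1) (step thr order m s (ω m)) + 1) ≤
          (U + 2) * invCount L m s := Nat.mul_le_mul_left _ hlt
      rw [mul_add] at this
      split_ifs <;> omega
    rw [hΦ]
    refine (Nat.add_le_add_left ?_ _).trans (h1.trans (Nat.le_add_right _ _))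
    split_ifs <;> omega
  -- The exceptional value `U + 1` cannot arise while the orderings stay fixed, by
  -- `exists_flagged_offGoal`.
  · have hnst : ¬ ((flagged (m + 1) (step thr order m s (ω m))).Nonempty ∧
        Disjoint (flagged (m + 1) (step thr order m s (ω m)))
          (offGoal (m + 1) (step thr order m s (ω m)))) := by
      rintro ⟨h1, h2⟩
      obtain ⟨j, hj1, hj2⟩ := exists_flagged_offGoal hm (rank_le_est ω m) hex hsig h1
      exact Finset.disjoint_left.1 h2 hj1 hj2
    have hsub := mem_offGoal_of_step (s := s) (x := ω m) hm hex hsig hdraw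
    rw [hΦ', if_neg hnst, hΦ, heq]
    have h1 := Finset.card_le_card hsub
    have h2 := card_offGoal_le m s
    have h3 : (offGoal m s \ flagged m s).card ≤ (offGoal m s).card :=
      Finset.card_le_card Finset.sdiff_subset
    split_ifs with h4 h5 h5
    · omega
    · have h6 : ¬ Disjoint (flagged m s) (offGoal m s) := fun h => h5 ⟨h4, h⟩
      obtain ⟨j, hj1, hj2⟩ := Finset.not_disjoint_iff.1 h6
      have : (offGoal m s \ flagged m s).card < (offGoal m s).card :=
        Finset.card_lt_card (Finset.ssubset_iff_subset_ne.2 ⟨Finset.sdiff_subset, fun h => by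
          rw [← h] at hj2
          exact (Finset.mem_sdiff.1 hj2).2 hj1⟩)
      omega
    · exact absurd h5.1 h4
    · omega

/-- In a pending state, the budget increases if every user that draws draws its old rank. -/
lemma budget_lt_of_pending {m : ℕ} {ω : ℕ → Slot C U} (hm : C ≤ m)
    (hp : Pending L m (states thr order ω m))
    (hdraw : ∀ j, (states thr order ω m j).nextRank ((ω m).2 j) = (states thr order ω m j).rank) :
    budget L (states thr order ω m) < budget L (states thr order ω (m + 1)) := by
  obtain ⟨j, hj⟩ := hp
  refine budget_lt_of_sensed (j := j) ?_
  rw [channels_eq hm, hdraw]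
  exact hj

lemma exists_draw_event {m : ℕ} {ω : ℕ → Slot C U} (v : Fin U → Fin C)
    (hv : ∀ j, v j ≤ (states thr order ω m j).est) :
    ∃ A : Set (Slot C U), (1 / (C : ℝ)) ^ U ≤ (slotLaw C U μ).real A ∧ ∀ x ∈ A, ∀ j,
      (states thr order ω m j).flag = true →
        (states thr order ω m j).nextRank (x.2 j) = v j := by
  refine ⟨_, le_slotLaw_real_draws (fun j => (states thr order ω m j).est)
    (fun j => ⟨v j, Nat.lt_succ_iff.2 (hv j)⟩), fun x hx j hj => ?_⟩
  rw [UserState.nextRank, if_pos hj, hx j]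
  rfl

/-- Success means that pending users redraw their old ranks, or that redrawing settlers draw their
goals; either has probability at least `C⁻ᵁ`. In the remaining slots settlers stay put, and redraws
of the others cannot disturb the potential. -/
theorem integral_relevantCount_le (hU : 1 ≤ U) (hUC : U ≤ C) (hε : 0 < ε) (hL : 0 < L)
    (hgap : ∀ i i', μ i < μ i' → (μ i : ℝ) + 4 * ε ≤ μ i') (hinj : Function.Injective μ) (n : ℕ) :
    ∫ ω, base ((1 / (C : ℝ)) ^ U) (potentialBound C U) ^ relevantCount thr order μ L ε n ω *
      ((1 / 2) ^ budget L (states thr order ω n) *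
        weight ((1 / (C : ℝ)) ^ U) (potential thr order μ L ε n ω)) ∂(systemLaw C U μ) ≤ 2 := by
  have hC : (1 : ℝ) ≤ C := by exact_mod_cast NeZero.one_le
  refine integral_potential_le (δ := (1 / (C : ℝ)) ^ U) (by positivity)
    (pow_le_one₀ (by positivity) (by rw [div_le_one (by linarith)]; exact hC))
    (R := Relevant thr order μ L ε)
    dependsOn_relevantCount (B := fun m ω => budget L (states thr order ω m))
    (fun m ω ω' h => congrArg (budget L) (dependsOn_states thr order le_rfl h))
    dependsOn_potential (fun ω => by simp [relevantCount])
    (fun m ω h => relevantCount_succ_of_relevant h)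
    (fun m ω h => relevantCount_succ_of_not_relevant h) (fun m ω => budget_le_step) potential_le
    ?_ ?_ (fun m => dependsOn_relevant le_rfl) n
  · rintro m ω ⟨hm, ha, hr⟩
    have hup (x : Slot C U) : ∀ t ∈ Set.Iio m, Function.update ω m x t = ω t := fun t ht => by
      simp [(Set.mem_Iio.1 ht).ne]
    have hst (x : Slot C U) : states thr order (Function.update ω m x) m = states thr order ω m :=
      dependsOn_states thr order le_rfl (hup x)
    by_cases hp : Pending L m (states thr order ω m)
    · obtain ⟨A, hA, hA'⟩ := exists_draw_event (μ := μ) (fun j => (states thr order ω m j).rank)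
        (rank_le_est ω m)
      refine ⟨A, hA, fun x hx => Or.inl ?_⟩
      have := budget_lt_of_pending (thr := thr) (order := order) (ω := Function.update ω m x) hm
        (by rwa [hst]) (fun j => ?_)
      · rwa [hst] at this
      · rw [hst, Function.update_self]
        by_cases hf : (states thr order ω m j).flag = true
        · exact hA' x hx j hf
        · rw [UserState.nextRank, if_neg hf]
    · have hfl := hr.resolve_left hp
      set s := states thr order ω m with hs
      have hgoal (j : Fin U) : ∃ r ≤ (s j).est,
          j ∈ flagged m s → sigma ((s j).gMean m) r = goal (window m s) j := by
        by_cases hj : j ∈ flagged m s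
        · have := (goal_spec (window m s)).1 j (Finset.mem_filter.1 hj).1
          obtain ⟨r, hr, hr'⟩ := Finset.mem_image.1 this
          exact ⟨r, Finset.mem_Iic.1 hr, fun _ => hr'⟩
        · exact ⟨(s j).est, le_rfl, fun h => absurd h hj⟩
      choose v hv hv' using hgoal
      obtain ⟨A, hA, hA'⟩ := exists_draw_event (μ := μ) v hv
      refine ⟨A, hA, fun x hx => ?_⟩
      have hal : Alive thr order μ L ε m (Function.update ω m x) := by
        rwa [dependsOn_alive le_rfl (hup x)]
      have := potential_step hU hUC hε hL hgap hinj hm hal (by rwa [hst]) (fun j hj => ?_)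
      · rw [hst, dependsOn_potential m (hup x), if_pos hfl] at this
        exact this
      · rw [hst] at hj
        rw [hst, Function.update_self,
          show (s j).nextRank (x.2 j) = v j from hA' x hx j (Finset.mem_filter.1 hj).2]
        exact hv' j hj
  · intro m ω hr
    rcases lt_or_ge m C with hm | hm
    · right
      rw [potential.eq_def thr order μ L ε m ω, if_pos hm]
      exact potential_le _ _
    by_cases ha : Alive thr order μ L ε m ω
    · simp only [Relevant, hm, ha, true_and, not_or] at hr
      have := potential_step hU hUC hε hL hgap hinj hm ha hr.1 fun j hj => absurd ⟨j, hj⟩ hr.2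
      rwa [if_neg hr.2, add_zero] at this
    · right
      have ha' : ¬ Alive thr order μ L ε (m + 1) ω := fun h => ha (h.mono (Nat.le_succ m))
      rw [potential, if_neg (by omega), if_pos (Or.inl ha')]
      exact Nat.zero_le _

end Overestimation

/-! ### The probability of overestimating the number of users. -/

section Overestimation

variable {C U : ℕ}

lemma card_window (m : ℕ) (s : Fin U → UserState C) (j : Fin U) :
    (window m s j).card = (s j).est + 1 := by
  rw [window, Finset.card_image_of_injective _ (Equiv.injective _), Fin.card_Iic]

variable [NeZero C] {thr : ℕ → ℝ} {order : Fin U → Equiv.Perm (Fin C)} {μ : Fin C → I}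
  {L : ℕ} {ε : ℝ}

/-- A user with estimate `U` has a window of `U` channels and is therefore a settler, so each
retained collision makes the following slot relevant. The flag accounts for the last collision,
whose relevant slot is still to come. -/
lemma sum_coll_le_relevantCount {m : ℕ} {ω : ℕ → Slot C U} (ha : Alive thr order μ L ε m ω)
    {j : Fin U} (hj : ((states thr order ω m j).est : ℕ) + 1 = U) :
    ∑ i, (states thr order ω m j).coll i ≤ relevantCount thr order μ L ε m ω +
      if (states thr order ω m j).flag = true then 1 else 0 := by
  induction m with
  | zero => simp [states, UserState.initial]
  | succ m ih =>
    rcases lt_or_ge m C with hm | hm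
    · simp [(states_early (thr := thr) (order := order) ω (show m + 1 ≤ C from hm) j).1]
    have ha' := ha.mono (Nat.le_succ m)
    by_cases he : Exceeds thr order m (states thr order ω m) (ω m) j
    · rw [states, (step_of_exceeds hm he).1]
      simp
    obtain ⟨h1, h2, h3⟩ := step_of_not_exceeds hm he
    rw [states, h3] at hj
    have ih := ih ha' hj
    rw [states, h1, h2]
    refine sum_collNext.le.trans (Nat.add_le_add_right ?_ _)
    by_cases hf : (states thr order ω m j).flag = true
    · have hrel : Relevant thr order μ L ε m ω := by
        refine ⟨hm, ha', Or.inr ⟨j, Finset.mem_filter.2 ⟨?_, hf⟩⟩⟩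
        exact (goal_spec _).2.2.2 j (by rw [card_window, hj])
      rw [relevantCount_succ_of_relevant hrel]
      simpa [hf] using ih
    · have := relevantCount_mono (thr := thr) (order := order) (μ := μ) (L := L) (ε := ε) ω
        (Nat.le_succ m)
      simp only [hf, Bool.false_eq_true, if_false, add_zero] at ih
      exact ih.trans this

/-- At the first `Trigger` the system is still alive. The `2` stands for the collision flagged from
the slot before and the one of the triggering slot itself. -/
lemma lt_relevantCount_of_not_alive {n : ℕ} {ω : ℕ → Slot C U}
    (hacc : ∀ t ≤ n, Accurate μ L ε (states thr order ω t))
    (hlog : 2 * Real.log n ≤ ε ^ 2 * L) (hna : ¬ Alive thr order μ L ε n ω) :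
    thr U < relevantCount thr order μ L ε n ω + 2 := by
  classical
  have hex : ∃ t, t < n ∧ Trigger thr order t (states thr order ω t) (ω t) := by
    by_contra h
    push Not at h
    exact hna ⟨h, hacc, hlog⟩
  obtain ⟨htn, hm, j, hj, he⟩ := Nat.find_spec hex
  set t := Nat.find hex
  have ha : Alive thr order μ L ε t ω := by
    refine ⟨fun u hu h => Nat.find_min hex hu ⟨hu.trans htn, h⟩,
      fun u hu => hacc u (hu.trans htn.le), le_trans ?_ hlog⟩
    have : Real.log t ≤ Real.log n :=
      Real.log_le_log (by exact_mod_cast (NeZero.pos C).trans_le hm) (by exact_mod_cast htn.le)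
    linarith
  have h1 := sum_coll_le_relevantCount ha hj
  have h2 := (collisionCount_le ((states thr order ω t j).gMean t)
    (collNext order t (states thr order ω t) (ω t) j) (states thr order ω t j).est).trans
    sum_collNext.le
  have h3 : relevantCount thr order μ L ε t ω ≤ relevantCount thr order μ L ε n ω :=
    relevantCount_mono ω htn.le
  have h4 : collisionCount ((states thr order ω t j).gMean t)
      (collNext order t (states thr order ω t) (ω t) j) (states thr order ω t j).est ≤
      relevantCount thr order μ L ε n ω + 2 := by
    refine h2.trans ?_
    split_ifs at h1 ⊢ <;> omega
  rw [Exceeds, hj] at he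
  refine he.trans_le ?_
  exact_mod_cast h4

/-- Markov's inequality for the supermartingale. The factor with the maximal budget is polynomial in
`n` when `L` is of order `log n`, and loses to a superlogarithmic `thr U`. -/
theorem systemLaw_not_alive_le (hU : 1 ≤ U) (hUC : U ≤ C) (hε : 0 < ε) (hL : 0 < L)
    (hgap : ∀ i i', μ i < μ i' → (μ i : ℝ) + 4 * ε ≤ μ i') (hinj : Function.Injective μ) {n : ℕ}
    (hlog : 2 * Real.log n ≤ ε ^ 2 * L) :
    (systemLaw C U μ).real {ω | (∀ t ≤ n, Accurate μ L ε (states thr order ω t)) ∧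
      ¬ Alive thr order μ L ε n ω} ≤
    2 / (base ((1 / (C : ℝ)) ^ U) (potentialBound C U) ^ (thr U - 2) *
      (1 / 2) ^ (U * (C * L + C))) := by
  have hC : (1 : ℝ) ≤ C := by exact_mod_cast NeZero.one_le
  have h0 : 0 < (1 / (C : ℝ)) ^ U := by positivity
  have h1 : (1 / (C : ℝ)) ^ U ≤ 1 :=
    pow_le_one₀ (by positivity) (by rw [div_le_one (by linarith)]; exact hC)
  have hb := one_lt_base h0 h1 (potentialBound C U)
  have hb0 : 0 < base ((1 / (C : ℝ)) ^ U) (potentialBound C U) := by linarith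
  refine systemLaw_real_le (m := n) (fun ω ω' h => ?_) (fun ω => ?_) (by positivity) (fun ω hω => ?_)
    (integral_relevantCount_le (thr := thr) (order := order) hU hUC hε hL hgap hinj n)
  · simp only [dependsOn_relevantCount n h, dependsOn_potential n h,
      dependsOn_states thr order le_rfl h]
  · have := one_le_weight h0 h1 (potential thr order μ L ε n ω)
    positivity
  · have h2 := lt_relevantCount_of_not_alive hω.1 hlog hω.2
    have h3 := one_le_weight h0 h1 (potential thr order μ L ε n ω)
    refine mul_le_mul ?_ ?_ (by positivity) (by positivity)
    · rw [← Real.rpow_natCast _ (relevantCount _ _ _ _ _ _ _)]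
      exact Real.rpow_le_rpow_of_exponent_le hb.le (by linarith)
    · calc (1 / 2 : ℝ) ^ (U * (C * L + C)) ≤ (1 / 2) ^ budget L (states thr order ω n) * 1 := by
            rw [mul_one]
            exact pow_le_pow_of_le_one (by norm_num) (by norm_num) (budget_le _)
        _ ≤ _ := by gcongr

end Overestimation

/-! ### Deviation bounds for sample means with random sample sizes. -/

section Concentration

variable {C U : ℕ} {thr : ℕ → ℝ} {order : Fin U → Equiv.Perm (Fin C)} {μ : Fin C → I}

/-- Hoeffding's lemma for a Bernoulli variable. -/
lemma bernoulli_mgf_le (p : I) (l : ℝ) :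
    (p : ℝ) * Real.exp (l * (1 - p)) + (1 - p) * Real.exp (l * (0 - p)) ≤ Real.exp (l ^ 2 / 8) := by
  have h := (hasSubgaussianMGF_of_mem_Icc_of_integral_eq_zero
    (μ := bernoulliMeasure true false p) (X := fun b => (if b then (1 : ℝ) else 0) - p)
    (a := -p) (b := 1 - p) (Measurable.of_discrete).aemeasurable
    (Eventually.of_forall fun b => by
      cases b <;> simp) (by rw [integral_bernoulliMeasure]; simp; ring)).mgf_le l
  rw [mgf, integral_bernoulliMeasure] at h
  simp only [if_true, Bool.false_eq_true, if_false, smul_eq_mul] at h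
  refine h.trans (Real.exp_le_exp.2 (le_of_eq ?_))
  simp
  ring

/-- The exponential supermartingale of the sample mean of channel `i` at user `j`. -/
noncomputable def expDeviation (μ : Fin C → I) (l : ℝ) (j : Fin U) (i : Fin C)
    (s : Fin U → UserState C) : ℝ :=
  Real.exp (l * ((s j).free i - μ i * (s j).sensed i) - l ^ 2 / 8 * (s j).sensed i)

lemma expDeviation_step (l : ℝ) (j : Fin U) (i : Fin C) (m : ℕ) (s : Fin U → UserState C)
    (x : Slot C U) : expDeviation μ l j i (step thr order m s x) = expDeviation μ l j i s *
      (if (s j).nextChannel (order j) m (x.2 j) = i then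
        Real.exp (l * ((if x.1 ((s j).nextChannel (order j) m (x.2 j)) then (1 : ℝ) else 0) - μ i) -
          l ^ 2 / 8) else 1) := by
  unfold expDeviation
  rw [step_sensed, step_free]
  change Real.exp (l * ((((if x.1 ((s j).nextChannel (order j) m (x.2 j)) = true then
    Function.update (s j).free ((s j).nextChannel (order j) m (x.2 j))
      ((s j).free ((s j).nextChannel (order j) m (x.2 j)) + 1) else (s j).free) i : ℕ) : ℝ) -
    μ i * ((Function.update (s j).sensed ((s j).nextChannel (order j) m (x.2 j))
      ((s j).sensed ((s j).nextChannel (order j) m (x.2 j)) + 1) i : ℕ) : ℝ)) -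
    l ^ 2 / 8 * ((Function.update (s j).sensed ((s j).nextChannel (order j) m (x.2 j))
      ((s j).sensed ((s j).nextChannel (order j) m (x.2 j)) + 1) i : ℕ) : ℝ)) = _
  generalize (s j).nextChannel (order j) m (x.2 j) = c
  by_cases hc : c = i
  · subst hc
    simp only [if_true, Function.update_self]
    rw [← Real.exp_add]
    split_ifs
    · simp only [Function.update_self]
      push_cast
      ring_nf
    · push_cast
      ring_nf
  · have hc' : i ≠ c := fun h => hc h.symm
    simp only [hc, if_false, mul_one, Function.update_of_ne hc']
    split_ifs
    · rw [Function.update_of_ne hc']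
    · rfl

variable [NeZero C]

/-- The choice of channel depends only on the past and the draws, never on the present availability,
so Hoeffding's lemma applies slot by slot although the sample size is random. -/
lemma integral_expDeviation_le (l : ℝ) (j : Fin U) (i : Fin C) (m : ℕ) :
    ∫ ω, expDeviation μ l j i (states thr order ω m) ∂(systemLaw C U μ) ≤ 1 := by
  induction m with
  | zero => simp [expDeviation, states, UserState.initial]
  | succ m ih =>
    refine le_trans ?_ ih
    have dF : DependsOn (fun ω x => expDeviation μ l j i (step thr order m (states thr order ω m) x))
        (Set.Iio m) := fun ω ω' h => by
      simp only [dependsOn_states thr order le_rfl h]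
    have h1 := integral_slot_eq (μ := μ) dF
    simp only [states]
    rw [h1]
    refine integral_mono (integrable_of_dependsOn (m := m) fun ω ω' h => ?_)
      (integrable_of_dependsOn (m := m) fun ω ω' h => ?_) fun ω => ?_
    · exact congrArg (fun f => ∫ x, f x ∂(slotLaw C U μ)) (dF h)
    · simp only [dependsOn_states thr order le_rfl h]
    set s := states thr order ω m
    simp only [expDeviation_step]
    rw [integral_const_mul]
    refine mul_le_of_le_one_right (Real.exp_pos _).le ?_
    rw [integral_slotLaw_eq (fun d b => if (s j).nextChannel (order j) m (d j) = i then
        Real.exp (l * ((if b then (1 : ℝ) else 0) - μ i) - l ^ 2 / 8) else 1)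
      (fun d => (s j).nextChannel (order j) m (d j))]
    calc _ ≤ ∫ _, (1 : ℝ) ∂(slotLaw C U μ) := by
          refine integral_mono Integrable.of_finite (integrable_const _) fun x => ?_
          simp only
          by_cases hc : (s j).nextChannel (order j) m (x.2 j) = i
          · simp only [hc, if_true, Bool.false_eq_true, if_false, Real.exp_sub _ (l ^ 2 / 8)]
            have := bernoulli_mgf_le (μ i) l
            have hp := Real.exp_pos (l ^ 2 / 8)
            rw [mul_div_assoc', mul_div_assoc', ← add_div, div_le_one hp]
            exact this
          · simp [hc]
      _ = 1 := by simp

lemma systemLaw_deviation_le (l c : ℝ) (j : Fin U) (i : Fin C) (m : ℕ)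
    {E : Set (ℕ → Slot C U)} (hE : ∀ ω ∈ E, c ≤ l * ((states thr order ω m j).free i -
      μ i * (states thr order ω m j).sensed i) - l ^ 2 / 8 * (states thr order ω m j).sensed i) :
    (systemLaw C U μ).real E ≤ Real.exp (-c) := by
  rw [Real.exp_neg, ← one_div]
  refine systemLaw_real_le (m := m) (fun ω ω' h => ?_) (fun ω => (Real.exp_pos _).le)
    (Real.exp_pos c) (fun ω hω => Real.exp_le_exp.2 (hE ω hω))
    (integral_expDeviation_le (thr := thr) (order := order) l j i m)
  simp only [dependsOn_states thr order le_rfl h]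

lemma systemLaw_not_accurate_le {L : ℕ} {ε : ℝ} (hε : 0 < ε) (hL : 0 < L) (m : ℕ) :
    (systemLaw C U μ).real {ω | ¬ Accurate μ L ε (states thr order ω m)} ≤
      U * (C * (2 * Real.exp (-(2 * ε ^ 2 * L)))) := by
  have hsub : {ω : ℕ → Slot C U | ¬ Accurate μ L ε (states thr order ω m)} ⊆
      ⋃ j ∈ (Finset.univ : Finset (Fin U)), ⋃ i ∈ (Finset.univ : Finset (Fin C)),
        {ω | L ≤ (states thr order ω m j).sensed i ∧
          ε < |((states thr order ω m j).free i : ℝ) / (states thr order ω m j).sensed i - μ i|} := by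
    intro ω hω
    simp only [Accurate, Set.mem_ofPred_eq] at hω
    push Not at hω
    obtain ⟨j, i, h⟩ := hω
    simp only [Set.mem_iUnion, Finset.mem_univ, exists_true_left]
    exact ⟨j, i, h⟩
  refine (measureReal_mono hsub (measure_ne_top _ _)).trans ?_
  refine (measureReal_biUnion_finset_le _ _).trans ?_
  calc _ ≤ ∑ _j : Fin U, ∑ _i : Fin C, 2 * Real.exp (-(2 * ε ^ 2 * L)) := by
        refine Finset.sum_le_sum fun j _ => (measureReal_biUnion_finset_le _ _).trans
          (Finset.sum_le_sum fun i _ => ?_)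
        have hsub2 : {ω : ℕ → Slot C U | L ≤ (states thr order ω m j).sensed i ∧
            ε < |((states thr order ω m j).free i : ℝ) /
              (states thr order ω m j).sensed i - μ i|} ⊆
            {ω | L ≤ (states thr order ω m j).sensed i ∧
              ε * (states thr order ω m j).sensed i ≤ (states thr order ω m j).free i -
                μ i * (states thr order ω m j).sensed i} ∪
            {ω | L ≤ (states thr order ω m j).sensed i ∧
              ε * (states thr order ω m j).sensed i ≤ -((states thr order ω m j).free i -
                μ i * (states thr order ω m j).sensed i)} := by
          rintro ω ⟨h1, h2⟩
          have hT : (0 : ℝ) < (states thr order ω m j).sensed i := by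
            exact_mod_cast hL.trans_le h1
          have e1 : ((states thr order ω m j).free i : ℝ) - μ i * (states thr order ω m j).sensed i =
              (((states thr order ω m j).free i : ℝ) / (states thr order ω m j).sensed i - μ i) *
                (states thr order ω m j).sensed i := by
            field_simp
          rcases lt_abs.1 h2 with h3 | h3
          · refine Or.inl ⟨h1, ?_⟩
            rw [e1]
            exact mul_le_mul_of_nonneg_right h3.le hT.le
          · refine Or.inr ⟨h1, ?_⟩
            rw [e1, ← neg_mul]
            exact mul_le_mul_of_nonneg_right h3.le hT.le
        refine (measureReal_mono hsub2 (measure_ne_top _ _)).trans ((measureReal_union_le _ _).trans ?_)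
        rw [two_mul]
        -- `l = 4ε` maximizes `l ε - l² / 8`, giving the exponent `2ε²T ≥ 2ε²L` for all sample sizes
        -- `T ≥ L` at once.
        refine add_le_add (systemLaw_deviation_le (thr := thr) (order := order) (4 * ε) _ j i m ?_)
          (systemLaw_deviation_le (thr := thr) (order := order) (-(4 * ε)) _ j i m ?_)
        all_goals
          rintro ω ⟨h1, h2⟩
          have hT : (L : ℝ) ≤ (states thr order ω m j).sensed i := by exact_mod_cast h1
          nlinarith [mul_le_mul_of_nonneg_left hT (sq_nonneg ε),
            mul_le_mul_of_nonneg_left h2 hε.le]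
    _ = _ := by simp

lemma systemLaw_gMean_lt_le (j : Fin U) (i : Fin C) {m : ℕ} (hm : C ≤ m) :
    (systemLaw C U μ).real {ω | (states thr order ω m j).gMean m i < μ i} ≤ 1 / (m : ℝ) ^ 3 := by
  have hm0 : (0 : ℝ) < m := by exact_mod_cast (NeZero.pos C).trans_le hm
  have hlog : 0 ≤ Real.log m := Real.log_natCast_nonneg m
  have hsub : {ω : ℕ → Slot C U | (states thr order ω m j).gMean m i < μ i} ⊆
      ⋃ t ∈ Finset.Icc 1 m, {ω | (states thr order ω m j).sensed i = t ∧
        (states thr order ω m j).gMean m i < μ i} := by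
    intro ω hω
    simp only [Set.mem_iUnion, Finset.mem_Icc]
    exact ⟨_, ⟨sensed_pos ω hm j i, sensed_le ω m j i⟩, rfl, hω⟩
  refine (measureReal_mono hsub (measure_ne_top _ _)).trans ((measureReal_biUnion_finset_le _ _).trans ?_)
  calc _ ≤ ∑ _t ∈ Finset.Icc 1 m, Real.exp (-(4 * Real.log m)) := by
        refine Finset.sum_le_sum fun t ht => ?_
        have ht0 : (0 : ℝ) < t := by exact_mod_cast (Finset.mem_Icc.1 ht).1
        -- Here the best `l` depends on the sample size `t`, hence the union over `t`. Each term is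
        -- `m⁻⁴`, and the union costs a factor `m`.
        refine systemLaw_deviation_le (thr := thr) (order := order) (-(4 * √(2 * Real.log m / t))) _ j i m ?_
        rintro ω ⟨h1, h2⟩
        rw [UserState.gMean, h1] at h2
        rw [h1]
        have hsq : √(2 * Real.log m / t) ^ 2 = 2 * Real.log m / t := Real.sq_sqrt (by positivity)
        have hr := Real.sqrt_nonneg (2 * Real.log m / t)
        set r := √(2 * Real.log m / t)
        have h3 : ((states thr order ω m j).free i : ℝ) - μ i * t ≤ -(r * t) := by
          have : ((states thr order ω m j).free i : ℝ) / t * t =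
            (states thr order ω m j).free i := by field_simp
          nlinarith
        have h4 : r ^ 2 * t = 2 * Real.log m := by rw [hsq]; field_simp
        nlinarith [mul_le_mul_of_nonneg_left h3 hr]
    _ = m * Real.exp (-(4 * Real.log m)) := by simp
    _ = 1 / (m : ℝ) ^ 3 := by
        have : Real.exp (-(4 * Real.log m)) = ((m : ℝ) ^ 4)⁻¹ := by
          rw [Real.exp_neg, mul_comm, Real.exp_mul, Real.exp_log hm0]
          norm_cast
        rw [this]
        field_simp

end Concentration

/-! ### Expected counts as sums of probabilities. -/

section Counting

variable {C U : ℕ} {μ : Fin C → I}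

lemma card_filter_range_succ (p : ℕ → Prop) [DecidablePred p] (n : ℕ) :
    ((Finset.range (n + 1)).filter p).card =
      ((Finset.range n).filter p).card + if p n then 1 else 0 := by
  rw [Finset.range_add_one, Finset.filter_insert]
  split_ifs
  · rw [Finset.card_insert_of_notMem (by simp)]
  · rfl

lemma integral_card_filter {n : ℕ} {p : ℕ → (ℕ → Slot C U) → Prop}
    [∀ ω, DecidablePred fun t => p t ω] [∀ t ω, Decidable (p t ω)]
    (hp : ∀ t < n, DependsOn (p t) (Set.Iio n)) :
    ∫ ω, (((Finset.range n).filter fun t => p t ω).card : ℝ) ∂(systemLaw C U μ) =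
      ∑ t ∈ Finset.range n, ∫ ω, (if p t ω then 1 else 0 : ℝ) ∂(systemLaw C U μ) := by
  rw [← integral_finsetSum]
  · congr 1
    funext ω
    rw [Finset.card_filter]
    push_cast
    exact Finset.sum_congr rfl fun t _ => by congr
  · intro t ht
    refine integrable_of_dependsOn (m := n) fun ω ω' h => ?_
    simp only [hp t (Finset.mem_range.1 ht) h]

lemma integral_ite_eq {n : ℕ} {p : (ℕ → Slot C U) → Prop} [DecidablePred p]
    (hp : DependsOn p (Set.Iio n)) :
    ∫ ω, (if p ω then 1 else 0 : ℝ) ∂(systemLaw C U μ) = (systemLaw C U μ).real {ω | p ω} := by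
  have hm : MeasurableSet {ω | p ω} := by
    obtain ⟨g, hg⟩ := exists_eq_comp_restrict hp
    have : {ω | p ω} = (Finset.range n).restrict ⁻¹' {a | g a} := by
      ext ω
      simp [hg]
    rw [this]
    exact Finset.measurable_restrict _ (MeasurableSet.of_discrete)
  rw [← integral_indicator_one hm]
  congr 1
  funext ω
  by_cases h : p ω <;> simp [h]

end Counting

/-! ### Collisions and shared slots while the system is alive. -/

section Collisions

variable {C U : ℕ} [NeZero C]

section Defs

variable (thr : ℕ → ℝ) (order : Fin U → Equiv.Perm (Fin C)) (μ : Fin C → I) (L : ℕ) (ε : ℝ)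

open Classical in
/-- The number of collisions of user `j` before slot `n`, as long as the system is alive. -/
noncomputable def hitCount (n : ℕ) (j : Fin U) (ω : ℕ → Slot C U) : ℕ :=
  ((Finset.range n).filter fun t => (C ≤ t ∧ Alive thr order μ L ε t ω) ∧
    hit order t (states thr order ω t) (ω t) j = true).card

open Classical in
/-- The number of slots before slot `n` in which user `j` shares its channel, as long as the system
is alive. -/
noncomputable def sharedCount (n : ℕ) (j : Fin U) (ω : ℕ → Slot C U) : ℕ :=
  ((Finset.range n).filter fun t => (C ≤ t ∧ Alive thr order μ L ε t ω) ∧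
    ¬ Sole (channelAt thr order ω t) j).card

end Defs

variable {thr : ℕ → ℝ} {order : Fin U → Equiv.Perm (Fin C)} {μ : Fin C → I} {L : ℕ} {ε : ℝ}

/-- A channel's count grows only when the channel is sensed, thus lies in the window and contributes
to the collision count compared with the threshold. Later it may leave the window, but then its
count stays put. -/
lemma coll_le (hU : 1 ≤ U) {X : ℝ} (hX : 0 ≤ X) (hthr : ∀ k, 1 ≤ k → k ≤ U → thr k ≤ X) {m : ℕ}
    {ω : ℕ → Slot C U} (ha : Alive thr order μ L ε m ω) (j : Fin U) (i : Fin C) :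
    ((states thr order ω m j).coll i : ℝ) ≤ X := by
  induction m generalizing i with
  | zero => simpa [states, UserState.initial] using hX
  | succ m ih =>
    rcases lt_or_ge m C with hm | hm
    · simpa [(states_early (thr := thr) (order := order) ω (show m + 1 ≤ C from hm) j).1] using hX
    have ha' := ha.mono (Nat.le_succ m)
    by_cases he : Exceeds thr order m (states thr order ω m) (ω m) j
    · simpa [states, (step_of_exceeds hm he).1] using hX
    rw [states, (step_of_not_exceeds hm he).1]
    by_cases hi : hit order m (states thr order ω m) (ω m) j = true ∧
        i = channels order m (states thr order ω m) (ω m) j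
    · have h1 : collNext order m (states thr order ω m) (ω m) j i ≤
          collisionCount ((states thr order ω m j).gMean m)
            (collNext order m (states thr order ω m) (ω m) j) (states thr order ω m j).est := by
        unfold collisionCount
        rw [hi.2, channels_eq hm]
        exact Finset.single_le_sum (f := fun k => collNext order m (states thr order ω m) (ω m) j
          (sigma ((states thr order ω m j).gMean m) k)) (fun _ _ => Nat.zero_le _)
          (Finset.mem_Iic.2 (nextRank_le _ (rank_le_est ω m j)))
      refine (Nat.cast_le.2 h1).trans ((not_lt.1 he).trans ?_)
      exact hthr _ (by omega) (ha'.est_lt hU j)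
    · have : collNext order m (states thr order ω m) (ω m) j i = (states thr order ω m j).coll i := by
        unfold collNext
        split_ifs with h
        · exact Function.update_of_ne (fun h' => hi ⟨h, h'⟩) _ _
        · rfl
      rw [this]
      exact ih ha' i

lemma sum_coll_le (hU : 1 ≤ U) {X : ℝ} (hX : 0 ≤ X) (hthr : ∀ k, 1 ≤ k → k ≤ U → thr k ≤ X)
    {m : ℕ} {ω : ℕ → Slot C U} (ha : Alive thr order μ L ε m ω) (j : Fin U) :
    ((∑ i, (states thr order ω m j).coll i : ℕ) : ℝ) ≤ C * X := by
  push_cast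
  calc _ ≤ ∑ _i : Fin C, X := Finset.sum_le_sum fun i _ => coll_le hU hX hthr ha j i
    _ = _ := by simp

/-- Collisions are either still recorded or were discarded; each raise of the estimate discards at
most `C * X` old ones and that of the present slot. -/
lemma hitCount_le_of_alive (hU : 1 ≤ U) (hUC : U ≤ C) {X : ℝ} (hX : 0 ≤ X)
    (hthr : ∀ k, 1 ≤ k → k ≤ U → thr k ≤ X) {m : ℕ} {ω : ℕ → Slot C U}
    (ha : Alive thr order μ L ε m ω) (j : Fin U) :
    (hitCount thr order μ L ε m j ω : ℝ) ≤ (states thr order ω m j).est * (C * X + 1) +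
      (∑ i, (states thr order ω m j).coll i : ℕ) := by
  classical
  induction m with
  | zero =>
    simp only [hitCount, Finset.range_zero, Finset.filter_empty, Finset.card_empty]
    push_cast
    positivity
  | succ m ih =>
    rw [hitCount, card_filter_range_succ, ← hitCount]
    rcases lt_or_ge m C with hm | hm
    · have : hitCount thr order μ L ε m j ω = 0 := by
        refine Finset.card_eq_zero.2 (Finset.filter_eq_empty_iff.2 fun t ht h => ?_)
        have := Finset.mem_range.1 ht
        have := h.1.1
        omega
      rw [this, if_neg (fun h => absurd h.1.1 (by omega))]
      push_cast
      positivity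
    have ha' := ha.mono (Nat.le_succ m)
    have ih := ih ha'
    have hif : ((if (C ≤ m ∧ Alive thr order μ L ε m ω) ∧
        hit order m (states thr order ω m) (ω m) j = true then 1 else 0 : ℕ) : ℝ) =
        ((if hit order m (states thr order ω m) (ω m) j = true then 1 else 0 : ℕ) : ℝ) := by
      simp [hm, ha']
    push_cast at hif
    push_cast
    rw [hif]
    by_cases he : Exceeds thr order m (states thr order ω m) (ω m) j
    · have hne : ((states thr order ω m j).est : ℕ) + 1 ≠ U := fun h =>
        ha.1 m (Nat.lt_succ_self m) ⟨hm, j, h, he⟩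
      have hlt := ha'.est_lt hU j
      rw [states, (step_of_exceeds hm he).1, (step_of_exceeds hm he).2.2, raise,
        dif_pos (show ((states thr order ω m j).est : ℕ) + 1 < C by omega)]
      have h1 := sum_coll_le hU hX hthr ha' j
      push_cast at ih h1 ⊢
      have h2 : (if hit order m (states thr order ω m) (ω m) j = true then 1 else 0 : ℝ) ≤ 1 := by
        split_ifs <;> norm_num
      simp only [Finset.sum_const_zero, add_zero]
      nlinarith
    · obtain ⟨h1, -, h3⟩ := step_of_not_exceeds hm he
      have h4 := sum_collNext (order := order) (m := m) (s := states thr order ω m) (x := ω m) (j := j)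
      have h5 := congrArg (Nat.cast : ℕ → ℝ) h4
      rw [states, h1, h3]
      push_cast at ih h5 ⊢
      rw [h5]
      linarith

lemma hitCount_le (hU : 1 ≤ U) (hUC : U ≤ C) {X : ℝ} (hX : 0 ≤ X)
    (hthr : ∀ k, 1 ≤ k → k ≤ U → thr k ≤ X) (n : ℕ) (ω : ℕ → Slot C U) (j : Fin U) :
    (hitCount thr order μ L ε n j ω : ℝ) ≤ U * (C * X + 1) := by
  classical
  induction n with
  | zero =>
    simp only [hitCount, Finset.range_zero, Finset.filter_empty, Finset.card_empty]
    push_cast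
    positivity
  | succ m ih =>
    rw [hitCount, card_filter_range_succ, ← hitCount]
    by_cases ha : Alive thr order μ L ε m ω
    · have h1 := hitCount_le_of_alive hU hUC hX hthr ha j
      have h2 := sum_coll_le hU hX hthr ha j
      have h3 : ((states thr order ω m j).est : ℝ) + 1 ≤ U := by exact_mod_cast ha.est_lt hU j
      have h4 : (((if (C ≤ m ∧ Alive thr order μ L ε m ω) ∧
          hit order m (states thr order ω m) (ω m) j = true then 1 else 0 : ℕ)) : ℝ) ≤ 1 := by
        split_ifs <;> norm_num
      have h5 : 0 ≤ (C : ℝ) * X := by positivity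
      rw [Nat.cast_add]
      nlinarith
    · rw [if_neg (fun h => ha h.1.2)]
      simpa using ih

/-- A shared channel is free with probability at least `μ₀`. -/
lemma integral_sharedCount_le {μ₀ : ℝ} (hμ₀ : ∀ i, μ₀ ≤ μ i) (n : ℕ) (j : Fin U) :
    μ₀ * ∫ ω, (sharedCount thr order μ L ε n j ω : ℝ) ∂(systemLaw C U μ) ≤
      ∫ ω, (hitCount thr order μ L ε n j ω : ℝ) ∂(systemLaw C U μ) := by
  classical
  unfold sharedCount hitCount
  have hst {t : ℕ} (ht : t < n) {ω ω' : ℕ → Slot C U} (h : ∀ i ∈ Set.Iio n, ω i = ω' i) :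
      states thr order ω t = states thr order ω' t ∧
      Alive thr order μ L ε t ω = Alive thr order μ L ε t ω' ∧ ω t = ω' t :=
    ⟨dependsOn_states thr order ht.le h, dependsOn_alive ht.le h, h t ht⟩
  rw [integral_card_filter, integral_card_filter, Finset.mul_sum]
  rotate_left
  · intro t ht ω ω' h
    obtain ⟨h1, h2, h3⟩ := hst ht h
    simp only [h1, h2, h3]
  · intro t ht ω ω' h
    obtain ⟨h1, h2, h3⟩ := hst ht h
    simp only [h2, channelAt, h1, h3]
  refine Finset.sum_le_sum fun t ht => ?_
  have dF : DependsOn (fun (ω : ℕ → Slot C U) (x : Slot C U) =>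
      (if (C ≤ t ∧ Alive thr order μ L ε t ω) ∧
        ¬ Sole (channels order t (states thr order ω t) x) j then 1 else 0 : ℝ)) (Set.Iio t) :=
    fun ω ω' h => by
      simp only [dependsOn_states thr order le_rfl h, dependsOn_alive le_rfl h]
  have dG : DependsOn (fun (ω : ℕ → Slot C U) (x : Slot C U) =>
      (if (C ≤ t ∧ Alive thr order μ L ε t ω) ∧
        hit order t (states thr order ω t) x j = true then 1 else 0 : ℝ)) (Set.Iio t) :=
    fun ω ω' h => by
      simp only [dependsOn_states thr order le_rfl h, dependsOn_alive le_rfl h]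
  have h1 := integral_slot_eq (μ := μ) dF
  have h2 := integral_slot_eq (μ := μ) dG
  unfold channelAt
  rw [h1, h2, ← integral_const_mul]
  refine integral_mono (integrable_of_dependsOn (m := t) fun ω ω' h => ?_)
    (integrable_of_dependsOn (m := t) fun ω ω' h => ?_) fun ω => ?_
  · exact congrArg (fun f => μ₀ * ∫ x, f x ∂(slotLaw C U μ)) (dF h)
  · exact congrArg (fun f => ∫ x, f x ∂(slotLaw C U μ)) (dG h)
  by_cases hal : C ≤ t ∧ Alive thr order μ L ε t ω
  · simp only [hal, and_self, true_and]
    set s := states thr order ω t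
    -- Given the past, who meets whom is decided by the draws alone, so the shared channel is free
    -- independently of being shared.
    let c : (Fin U → Draw C) → Fin U → Fin C := fun d j => (s j).nextChannel (order j) t (d j)
    have e2 : ∫ x, (if hit order t s x j = true then 1 else 0 : ℝ) ∂(slotLaw C U μ) =
        ∫ x, (fun (d : Fin U → Draw C) (b : Bool) =>
          (if b = true ∧ ¬ Sole (c d) j then 1 else 0 : ℝ)) x.2 (x.1 (c x.2 j))
          ∂(slotLaw C U μ) := by
      congr 1
      funext x
      have : hit order t s x j = true ↔ x.1 (c x.2 j) = true ∧ ¬ Sole (c x.2) j := by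
        rw [hit, Bool.and_eq_true, Bool.not_eq_true', decide_eq_false_iff_not]
        rfl
      simp only [this]
    rw [e2, integral_slotLaw_eq (fun (d : Fin U → Draw C) (b : Bool) =>
          (if b = true ∧ ¬ Sole (c d) j then 1 else 0 : ℝ)) (fun d => c d j),
      ← integral_const_mul]
    refine integral_mono Integrable.of_finite Integrable.of_finite fun x => ?_
    change μ₀ * (if ¬ Sole (c x.2) j then 1 else 0 : ℝ) ≤ _
    by_cases hso : Sole (c x.2) j
    · simp [hso]
    · simpa [hso] using hμ₀ _
  · simp [hal]

end Collisions

/-! ### The loss of a single slot. -/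

section Loss

variable {C : ℕ}

/-- The `U` best channels. -/
noncomputable def best (U : ℕ) (μ : Fin C → I) : Finset (Fin C) :=
  (Finset.univ.filter fun k : Fin C => k.val < U).image (sigma fun i => (μ i : ℝ))

variable {U : ℕ} {μ : Fin C → I}

lemma sum_best : ∑ i ∈ best U μ, (μ i : ℝ) =
    ∑ k ∈ Finset.univ.filter (fun k : Fin C => k.val < U),
      (μ (sigma (fun i => (μ i : ℝ)) k) : ℝ) :=
  Finset.sum_image (Equiv.injective _).injOn

lemma card_best (hUC : U ≤ C) : (best U μ).card = U := by
  rw [best, Finset.card_image_of_injective _ (Equiv.injective _), Fin.card_filter_val_lt]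
  omega

lemma mem_best {i : Fin C} :
    i ∈ best U μ ↔ ((sigma fun i => (μ i : ℝ)).symm i : ℕ) < U := by
  simp only [best, Finset.mem_image, Finset.mem_filter, Finset.mem_univ, true_and]
  refine ⟨?_, fun h => ⟨_, h, by simp⟩⟩
  rintro ⟨k, hk, rfl⟩
  simpa using hk

lemma le_of_mem_best {a b : Fin C} (ha : a ∈ best U μ) (hb : b ∉ best U μ) :
    (μ b : ℝ) ≤ μ a := by
  rw [mem_best] at ha hb
  have h : (sigma fun i => (μ i : ℝ)).symm a < (sigma fun i => (μ i : ℝ)).symm b :=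
    Fin.lt_def.2 (by omega)
  rcases (sigma_symm_lt_iff _ _ _).1 h with h | h
  · exact h.le
  · exact h.1.ge

lemma sum_le_sum_best (hUC : U ≤ C) {A : Finset (Fin C)} (hA : A.card ≤ U) :
    ∑ i ∈ A, (μ i : ℝ) ≤ ∑ i ∈ best U μ, (μ i : ℝ) := by
  set B := best U μ
  rw [← Finset.sum_inter_add_sum_sdiff A B, ← Finset.sum_inter_add_sum_sdiff B A,
    Finset.inter_comm B A]
  gcongr 1
  rcases (A \ B).eq_empty_or_nonempty with h | h
  · rw [h, Finset.sum_empty]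
    exact Finset.sum_nonneg fun i _ => (μ i).2.1
  obtain ⟨a, ha, hmax⟩ := Finset.exists_max_image (A \ B) (fun i => (μ i : ℝ)) h
  have hcard : (A \ B).card ≤ (B \ A).card := by
    have h1 := Finset.card_sdiff_add_card_inter A B
    have h2 := Finset.card_sdiff_add_card_inter B A
    have h3 : B.card = U := card_best hUC
    rw [Finset.inter_comm] at h2
    omega
  calc ∑ i ∈ A \ B, (μ i : ℝ) ≤ (A \ B).card • (μ a : ℝ) := Finset.sum_le_card_nsmul _ _ _ hmax
    _ ≤ (B \ A).card • (μ a : ℝ) := nsmul_le_nsmul_left (μ a).2.1 hcard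
    _ ≤ _ := Finset.card_nsmul_le_sum _ _ _ fun i hi =>
      le_of_mem_best (Finset.mem_sdiff.1 hi).1 (Finset.mem_sdiff.1 ha).2

open Classical in
/-- The expected loss in a slot in which the users sense the channels `c`. -/
noncomputable def loss (μ : Fin C → I) (c : Fin U → Fin C) : ℝ :=
  ∑ i ∈ best U μ, (μ i : ℝ) - ∑ j, if Sole c j then (μ (c j) : ℝ) else 0

lemma loss_nonneg (hUC : U ≤ C) (c : Fin U → Fin C) : 0 ≤ loss μ c := by
  classical
  rw [loss, sub_nonneg, ← Finset.sum_filter]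
  have hinj : Set.InjOn c (Finset.univ.filter fun j => Sole c j : Finset (Fin U)) := by
    intro j hj j' _ h
    by_contra hne
    exact (Finset.mem_filter.1 (Finset.mem_coe.1 hj)).2 j' (Ne.symm hne) h.symm
  rw [← Finset.sum_image (f := fun i => (μ i : ℝ)) hinj]
  refine sum_le_sum_best hUC (Finset.card_image_le.trans ?_)
  simpa using Finset.card_le_univ (Finset.univ.filter fun j => Sole c j)

lemma loss_le (hUC : U ≤ C) (c : Fin U → Fin C) : loss μ c ≤ U := by
  classical
  have h1 : 0 ≤ ∑ j, (if Sole c j then (μ (c j) : ℝ) else 0) :=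
    Finset.sum_nonneg fun j _ => by
      split_ifs
      · exact (μ _).2.1
      · exact le_rfl
  have h2 : ∑ i ∈ best U μ, (μ i : ℝ) ≤ U := by
    calc _ ≤ (best U μ).card • (1 : ℝ) := Finset.sum_le_card_nsmul _ _ _ fun i _ => (μ i).2.2
      _ = U := by simp [card_best hUC]
  unfold loss
  linarith

lemma loss_eq_zero (hUC : U ≤ C) {c : Fin U → Fin C} (hsole : ∀ j, Sole c j)
    (hbest : ∀ j, c j ∈ best U μ) : loss μ c = 0 := by
  classical
  have hinj : Function.Injective c := fun j j' h => by
    by_contra hne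
    exact hsole j j' (Ne.symm hne) h.symm
  have himg : Finset.univ.image c = best U μ := by
    refine Finset.eq_of_subset_of_card_le (fun i hi => ?_) ?_
    · obtain ⟨j, -, rfl⟩ := Finset.mem_image.1 hi
      exact hbest j
    · rw [card_best hUC, Finset.card_image_of_injective _ hinj]
      simp
  rw [loss, ← himg, Finset.sum_image hinj.injOn]
  simp [hsole]

end Loss

/-! ### Regret as expected total loss, and its sources. -/

section Regret

variable {C U : ℕ} [NeZero C] {thr : ℕ → ℝ} {order : Fin U → Equiv.Perm (Fin C)} {μ : Fin C → I}
  {L : ℕ} {ε : ℝ}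

lemma dependsOn_channelAt {t n : ℕ} (ht : t < n) :
    DependsOn (fun ω => channelAt thr order ω t) (Set.Iio n) := fun ω ω' h => by
  simp only [channelAt, dependsOn_states thr order ht.le h, h t ht]

/-- The identity already holds for every `ω` before integration, because `V` counts sole sensing
regardless of availability. -/
lemma regret_eq (ξ : ℕ → ℕ → ℝ) (n : ℕ) : regret C U μ order ξ n =
    ∫ ω, ∑ t ∈ Finset.range n, loss μ (channelAt (ξ n) order ω t) ∂(systemLaw C U μ) := by
  classical
  have hcount (ω : ℕ → Slot C U) : ∑ t ∈ Finset.range n, loss μ (channelAt (ξ n) order ω t) =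
      n * (∑ i ∈ best U μ, (μ i : ℝ)) -
        ∑ i : Fin C, ∑ j : Fin U, (μ i : ℝ) * (soleCount (ξ n) order n i j ω : ℝ) := by
    simp only [loss, Finset.sum_sub_distrib, Finset.sum_const, Finset.card_range, nsmul_eq_mul]
    congr 1
    rw [Finset.sum_comm, Finset.sum_comm (s := (Finset.univ : Finset (Fin C)))]
    refine Finset.sum_congr rfl fun j _ => ?_
    have h1 (i : Fin C) : (μ i : ℝ) * (soleCount (ξ n) order n i j ω : ℝ) =
        ∑ t ∈ Finset.range n, if channelAt (ξ n) order ω t j = i ∧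
          Sole (channelAt (ξ n) order ω t) j then (μ i : ℝ) else 0 := by
      rw [soleCount, Finset.card_filter]
      push_cast
      rw [Finset.mul_sum]
      refine Finset.sum_congr rfl fun t _ => ?_
      split_ifs <;> simp
    simp only [h1]
    rw [Finset.sum_comm]
    refine Finset.sum_congr rfl fun t _ => ?_
    by_cases hs : Sole (channelAt (ξ n) order ω t) j
    · simp [hs]
    · simp [hs]
  have hint (i : Fin C) (j : Fin U) : Integrable
      (fun ω => (μ i : ℝ) * (soleCount (ξ n) order n i j ω : ℝ)) (systemLaw C U μ) := by
    refine integrable_of_dependsOn (m := n) fun ω ω' h => ?_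
    simp only [soleCount]
    congr 3
    refine Finset.filter_congr fun t ht => ?_
    have := dependsOn_channelAt (thr := ξ n) (order := order) (Finset.mem_range.1 ht) h
    simp only at this
    rw [this]
  simp only [hcount]
  rw [integral_sub (integrable_const _)
    (integrable_finsetSum _ fun i _ => integrable_finsetSum _ fun j _ => hint i j),
    integral_finsetSum _ fun i _ => integrable_finsetSum _ fun j _ => hint i j]
  simp only [integral_finsetSum _ fun j _ => hint _ j, integral_const_mul, regret, sum_best]
  simp

lemma integrable_sum_loss (n : ℕ) : Integrable (fun ω => ∑ t ∈ Finset.range n,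
    loss μ (channelAt thr order ω t)) (systemLaw C U μ) := by
  refine integrable_of_dependsOn (m := n) fun ω ω' h => Finset.sum_congr rfl fun t ht => ?_
  have := dependsOn_channelAt (thr := thr) (order := order) (Finset.mem_range.1 ht) h
  simp only at this
  rw [this]

lemma regret_nonneg (hUC : U ≤ C) (ξ : ℕ → ℕ → ℝ) (n : ℕ) : 0 ≤ regret C U μ order ξ n := by
  rw [regret_eq]
  exact integral_nonneg fun ω => Finset.sum_nonneg fun t _ => loss_nonneg hUC _

/-- While the system is alive, a user senses a well-sampled channel outside the `U` best ones only
if it underestimates a channel. -/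
lemma exists_gMean_lt (hU : 1 ≤ U) (hUC : U ≤ C) (hε : 0 < ε) (hL : 0 < L)
    (hgap : ∀ i i', μ i < μ i' → (μ i : ℝ) + 4 * ε ≤ μ i') (hinj : Function.Injective μ)
    {t : ℕ} {ω : ℕ → Slot C U} (ht : C ≤ t) (ha : Alive thr order μ L ε t ω) {j : Fin U}
    (hwell : L ≤ (states thr order ω t j).sensed (channelAt thr order ω t j))
    (hout : channelAt thr order ω t j ∉ best U μ) :
    ∃ i, (states thr order ω t j).gMean t i < μ i := by
  set b := channelAt thr order ω t j with hb
  set g := (states thr order ω t j).gMean t with hg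
  have hbpos : ((sigma g).symm b : ℕ) < U := by
    rw [hb, channelAt, channels_eq ht, Equiv.symm_apply_apply]
    have h1 : ((states thr order ω t j).nextRank ((ω t).2 j) : ℕ) ≤ (states thr order ω t j).est :=
      nextRank_le _ (rank_le_est ω t j)
    have h2 := ha.est_lt hU j
    omega
  -- Fewer than `U` channels are ahead of `b`, so one of the `U` best is not.
  obtain ⟨a, haB, hab⟩ : ∃ a ∈ best U μ, ¬ (sigma g).symm a < (sigma g).symm b := by
    by_contra h
    push Not at h
    have h1 : best U μ ⊆ Finset.univ.filter fun z => (sigma g).symm z < (sigma g).symm b :=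
      fun a ha => Finset.mem_filter.2 ⟨Finset.mem_univ _, h a ha⟩
    have h2 := Finset.card_le_card h1
    rw [card_best hUC, card_filter_perm_lt] at h2
    omega
  have hne : a ≠ b := fun h => hout (h ▸ haB)
  have hlt : (sigma g).symm b < (sigma g).symm a :=
    lt_of_le_of_ne (not_lt.1 hab) fun h => hne ((sigma g).symm.injective h.symm)
  have hgab : g a ≤ g b := by
    rcases (sigma_symm_lt_iff _ _ _).1 hlt with h | h
    · exact h.le
    · exact h.1.ge
  have hμ : μ b < μ a := lt_of_le_of_ne (le_of_mem_best haB hout) (hinj.ne hne.symm)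
  have h3 := hgap _ _ hμ
  have h4 := ((ha.2.1 t le_rfl).gMean_mem hε.le hL ha.2.2 hwell).2
  exact ⟨a, by linarith⟩

lemma card_undersampled_le (n : ℕ) (ω : ℕ → Slot C U) [DecidablePred fun t =>
    ∃ j, (states thr order ω t j).sensed (channelAt thr order ω t j) < L] :
    ((Finset.range n).filter fun t =>
      ∃ j, (states thr order ω t j).sensed (channelAt thr order ω t j) < L).card ≤
      budget L (states thr order ω n) := by
  induction n with
  | zero => simp
  | succ n ih =>
    rw [card_filter_range_succ]
    split_ifs with h
    · obtain ⟨j, hj⟩ := h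
      exact Nat.succ_le_of_lt (ih.trans_lt (budget_lt_of_sensed hj))
    · exact ih.trans budget_le_step

open Classical in
/-- The number of slots before slot `n`, after the first `C` slots, in which user `j` underestimates
channel `i`. -/
noncomputable def underCount (thr : ℕ → ℝ) (order : Fin U → Equiv.Perm (Fin C)) (μ : Fin C → I)
    (n : ℕ) (j : Fin U) (i : Fin C) (ω : ℕ → Slot C U) : ℕ :=
  ((Finset.range n).filter fun t => C ≤ t ∧ (states thr order ω t j).gMean t i < μ i).card

-- While the system is alive, a slot with no undersampled sense, no underestimated channel and no
-- sharing is lossless after start-up; any other slot costs at most `U`. If the system dies before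
-- `n`, all `n` slots are charged.
open Classical in
lemma sum_loss_le (hU : 1 ≤ U) (hUC : U ≤ C) (hε : 0 < ε) (hL : 0 < L)
    (hgap : ∀ i i', μ i < μ i' → (μ i : ℝ) + 4 * ε ≤ μ i') (hinj : Function.Injective μ)
    (n : ℕ) (ω : ℕ → Slot C U) :
    ∑ t ∈ Finset.range n, loss μ (channelAt thr order ω t) ≤
      U * (C + n * (if ¬ Alive thr order μ L ε n ω then 1 else 0 : ℝ) + U * (C * L + C) +
        ∑ j, ∑ i, (underCount thr order μ n j i ω : ℝ) +
        ∑ j, (sharedCount thr order μ L ε n j ω : ℝ)) := by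
  by_cases ha : Alive thr order μ L ε n ω
  swap
  · calc _ ≤ ∑ _t ∈ Finset.range n, (U : ℝ) := Finset.sum_le_sum fun t _ => loss_le hUC _
      _ = U * n := by simp [mul_comm]
      _ ≤ _ := by
        rw [if_pos ha, mul_one]
        have h1 : (0 : ℝ) ≤ ∑ j, ∑ i, (underCount thr order μ n j i ω : ℝ) := by positivity
        have h2 : (0 : ℝ) ≤ ∑ j, (sharedCount thr order μ L ε n j ω : ℝ) := by positivity
        have h3 : (0 : ℝ) ≤ U * (C * L + C) := by positivity
        have h4 : (0 : ℝ) ≤ C := by positivity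
        gcongr
        linarith
  rw [if_neg (not_not.2 ha), mul_zero, add_zero]
  have hpt (t : ℕ) (ht : t ∈ Finset.range n) : loss μ (channelAt thr order ω t) ≤
      U * ((if t < C then 1 else 0) +
        (if ∃ j, (states thr order ω t j).sensed (channelAt thr order ω t j) < L then 1 else 0) +
        ∑ j, ∑ i, (if C ≤ t ∧ (states thr order ω t j).gMean t i < μ i then 1 else 0) +
        ∑ j, (if (C ≤ t ∧ Alive thr order μ L ε t ω) ∧
          ¬ Sole (channelAt thr order ω t) j then 1 else 0) : ℕ) := by
    by_cases hpos : (if t < C then 1 else 0) +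
        (if ∃ j, (states thr order ω t j).sensed (channelAt thr order ω t j) < L then 1 else 0) +
        ∑ j, ∑ i, (if C ≤ t ∧ (states thr order ω t j).gMean t i < μ i then 1 else 0) +
        ∑ j, (if (C ≤ t ∧ Alive thr order μ L ε t ω) ∧
          ¬ Sole (channelAt thr order ω t) j then 1 else 0) = 0
    · have hat := ha.mono (Finset.mem_range.1 ht).le
      simp only [add_eq_zero, Finset.sum_eq_zero_iff, Finset.mem_univ, true_implies,
        ite_eq_right_iff, one_ne_zero, imp_false] at hpos
      obtain ⟨⟨⟨h1, h2⟩, h3⟩, h4⟩ := hpos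
      have ht' : C ≤ t := not_lt.1 h1
      rw [loss_eq_zero hUC]
      · positivity
      · intro j
        by_contra h
        exact h4 j ⟨⟨ht', hat⟩, h⟩
      · intro j
        by_contra h
        push Not at h2
        obtain ⟨i, hi⟩ := exists_gMean_lt hU hUC hε hL hgap hinj ht' hat (h2 j) h
        exact h3 j i ⟨ht', hi⟩
    · refine (loss_le hUC _).trans (le_mul_of_one_le_right (by positivity) ?_)
      exact_mod_cast Nat.one_le_iff_ne_zero.2 hpos
  refine (Finset.sum_le_sum hpt).trans ?_
  rw [← Finset.mul_sum]
  gcongr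
  push_cast
  rw [Finset.sum_add_distrib, Finset.sum_add_distrib, Finset.sum_add_distrib]
  refine add_le_add (add_le_add (add_le_add ?_ ?_) ?_) ?_
  · calc ∑ t ∈ Finset.range n, (if t < C then 1 else 0 : ℝ)
        = (((Finset.range n).filter fun t => t < C).card : ℝ) := by
          rw [Finset.card_filter]; push_cast; rfl
      _ ≤ ((Finset.range C).card : ℝ) := by
          exact_mod_cast Finset.card_le_card fun t ht =>
            Finset.mem_range.2 (Finset.mem_filter.1 ht).2
      _ = C := by simp
  · have h1 := (card_undersampled_le (thr := thr) (order := order) (L := L) n ω).trans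
      (budget_le (states thr order ω n))
    rw [Finset.card_filter] at h1
    exact_mod_cast h1
  · rw [Finset.sum_comm]
    refine (Finset.sum_congr rfl fun j _ => ?_).le
    rw [Finset.sum_comm]
    refine Finset.sum_congr rfl fun i _ => ?_
    rw [underCount, Finset.card_filter]
    push_cast
    rfl
  · rw [Finset.sum_comm]
    refine (Finset.sum_congr rfl fun j _ => ?_).le
    rw [sharedCount, Finset.card_filter]
    push_cast
    rfl

end Regret

/-! ### Choice of parameters and the final estimate. -/

section Bound

section Parameters

variable {C U : ℕ}

lemma exists_gap (μ : Fin C → I) :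
    ∃ ε : ℝ, 0 < ε ∧ ∀ i i', μ i < μ i' → (μ i : ℝ) + 4 * ε ≤ μ i' := by
  classical
  set P := (Finset.univ : Finset (Fin C × Fin C)).filter fun q => μ q.1 < μ q.2 with hP
  rcases P.eq_empty_or_nonempty with h | h
  · refine ⟨1, one_pos, fun i i' hi => ?_⟩
    have : (i, i') ∈ P := by simpa [hP] using hi
    simp [h] at this
  · obtain ⟨q, hq, hmin⟩ := Finset.exists_min_image P (fun q => (μ q.2 : ℝ) - μ q.1) h
    have hq' : (μ q.1 : ℝ) < μ q.2 := (Finset.mem_filter.1 hq).2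
    refine ⟨((μ q.2 : ℝ) - μ q.1) / 4, by linarith, fun i i' hi => ?_⟩
    have := hmin (i, i') (by simpa [hP] using hi)
    simp only at this
    linarith

lemma le_maxThreshold (ξ : ℕ → ℕ → ℝ) (n : ℕ) {k : ℕ} (h1 : 1 ≤ k) (h2 : k ≤ U) :
    ξ n k ≤ maxThreshold ξ U n := by
  refine le_trans (le_of_eq ?_) (le_ciSup (f := fun k : Fin U => ξ n (k + 1))
    (Set.finite_range _).bddAbove ⟨k - 1, by omega⟩)
  simp [Nat.sub_add_cancel h1]

end Parameters

variable {C U : ℕ} [NeZero C] {thr : ℕ → ℝ} {order : Fin U → Equiv.Perm (Fin C)} {μ : Fin C → I}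
  {L : ℕ} {ε : ℝ}

lemma systemLaw_dead_le (hU : 1 ≤ U) (hUC : U ≤ C) (hε : 0 < ε) (hL : 0 < L)
    (hgap : ∀ i i', μ i < μ i' → (μ i : ℝ) + 4 * ε ≤ μ i') (hinj : Function.Injective μ) {n : ℕ}
    (hlog : 2 * Real.log n ≤ ε ^ 2 * L) :
    (systemLaw C U μ).real {ω | ¬ Alive thr order μ L ε n ω} ≤
      (n + 1) * (U * (C * (2 * Real.exp (-(2 * ε ^ 2 * L))))) +
      2 / (base ((1 / (C : ℝ)) ^ U) (potentialBound C U) ^ (thr U - 2) *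
        (1 / 2) ^ (U * (C * L + C))) := by
  have hsub : {ω : ℕ → Slot C U | ¬ Alive thr order μ L ε n ω} ⊆
      (⋃ t ∈ Finset.range (n + 1), {ω | ¬ Accurate μ L ε (states thr order ω t)}) ∪
      {ω | (∀ t ≤ n, Accurate μ L ε (states thr order ω t)) ∧ ¬ Alive thr order μ L ε n ω} := by
    intro ω hω
    by_cases h : ∀ t ≤ n, Accurate μ L ε (states thr order ω t)
    · exact Or.inr ⟨h, hω⟩
    · push Not at h
      obtain ⟨t, ht, h⟩ := h
      refine Or.inl ?_
      simp only [Set.mem_iUnion]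
      exact ⟨t, Finset.mem_range.2 (by omega), h⟩
  refine (measureReal_mono hsub (measure_ne_top _ _)).trans ((measureReal_union_le _ _).trans ?_)
  refine add_le_add ((measureReal_biUnion_finset_le _ _).trans ?_)
    (systemLaw_not_alive_le hU hUC hε hL hgap hinj hlog)
  calc _ ≤ ∑ _t ∈ Finset.range (n + 1), (U * (C * (2 * Real.exp (-(2 * ε ^ 2 * L)))) : ℝ) :=
        Finset.sum_le_sum fun t _ => systemLaw_not_accurate_le hε hL t
    _ = _ := by simp

lemma integral_underCount_le (n : ℕ) (j : Fin U) (i : Fin C) :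
    ∫ ω, (underCount thr order μ n j i ω : ℝ) ∂(systemLaw C U μ) ≤ ∑' t : ℕ, 1 / (t : ℝ) ^ 3 := by
  classical
  have hdep (t : ℕ) (ht : t < n) : DependsOn (fun ω : ℕ → Slot C U =>
      C ≤ t ∧ (states thr order ω t j).gMean t i < μ i) (Set.Iio n) := fun ω ω' h => by
    simp only [dependsOn_states thr order ht.le h]
  unfold underCount
  rw [integral_card_filter hdep]
  calc _ ≤ ∑ t ∈ Finset.range n, 1 / (t : ℝ) ^ 3 := by
        refine Finset.sum_le_sum fun t ht => ?_
        rw [integral_ite_eq (hdep t (Finset.mem_range.1 ht))]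
        by_cases hC : C ≤ t
        · simp only [hC, true_and]
          exact systemLaw_gMean_lt_le j i hC
        · simp only [hC, false_and]
          have : {_ω : ℕ → Slot C U | False} = ∅ := by ext; simp
          rw [this, measureReal_empty]
          positivity
    _ ≤ _ := (Real.summable_one_div_nat_pow.2 (by norm_num)).sum_le_tsum _
        fun t _ => by positivity

lemma integral_sharedCount_le_div (hU : 1 ≤ U) (hUC : U ≤ C) {X μ₀ : ℝ} (hX : 0 ≤ X)
    (hthr : ∀ k, 1 ≤ k → k ≤ U → thr k ≤ X) (h0 : 0 < μ₀) (hμ₀ : ∀ i, μ₀ ≤ μ i) (n : ℕ)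
    (j : Fin U) : ∫ ω, (sharedCount thr order μ L ε n j ω : ℝ) ∂(systemLaw C U μ) ≤
      U * (C * X + 1) / μ₀ := by
  rw [le_div_iff₀ h0, mul_comm]
  refine (integral_sharedCount_le hμ₀ n j).trans ?_
  calc _ ≤ ∫ _, (U * (C * X + 1) : ℝ) ∂(systemLaw C U μ) := by
        refine integral_mono_of_nonneg (Eventually.of_forall fun ω => Nat.cast_nonneg _)
          (integrable_const _) (Eventually.of_forall fun ω => hitCount_le hU hUC hX hthr n ω j)
    _ = _ := by simp

lemma dependsOn_sharedCount (n : ℕ) (j : Fin U) :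
    DependsOn (sharedCount thr order μ L ε n j) (Set.Iio n) := fun ω ω' h => by
  classical
  refine congrArg Finset.card (Finset.filter_congr fun t ht => ?_)
  have ht := Finset.mem_range.1 ht
  have h1 := dependsOn_channelAt (thr := thr) (order := order) ht h
  simp only at h1
  rw [dependsOn_alive ht.le h, h1]

lemma dependsOn_underCount (n : ℕ) (j : Fin U) (i : Fin C) :
    DependsOn (underCount thr order μ n j i) (Set.Iio n) := fun ω ω' h => by
  classical
  refine congrArg Finset.card (Finset.filter_congr fun t ht => ?_)
  have h1 := dependsOn_states thr order (Finset.mem_range.1 ht).le h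
  simp only at h1
  rw [h1]

theorem integral_sum_loss_le (hU : 1 ≤ U) (hUC : U ≤ C) (hε : 0 < ε) (hL : 0 < L)
    (hgap : ∀ i i', μ i < μ i' → (μ i : ℝ) + 4 * ε ≤ μ i') (hinj : Function.Injective μ)
    {X μ₀ : ℝ} (hX : 0 ≤ X) (hthr : ∀ k, 1 ≤ k → k ≤ U → thr k ≤ X) (h0 : 0 < μ₀)
    (hμ₀ : ∀ i, μ₀ ≤ μ i) (n : ℕ) :
    ∫ ω, ∑ t ∈ Finset.range n, loss μ (channelAt thr order ω t) ∂(systemLaw C U μ) ≤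
      U * (C + n * (systemLaw C U μ).real {ω | ¬ Alive thr order μ L ε n ω} + U * (C * L + C) +
        U * (C * ∑' t : ℕ, 1 / (t : ℝ) ^ 3) + U * (U * (C * X + 1) / μ₀)) := by
  classical
  have i1 : Integrable (fun ω => (if ¬ Alive thr order μ L ε n ω then 1 else 0 : ℝ))
      (systemLaw C U μ) := integrable_of_dependsOn (m := n) fun ω ω' h => by
    simp only [dependsOn_alive le_rfl h]
  have i2 (j : Fin U) (i : Fin C) : Integrable (fun ω => (underCount thr order μ n j i ω : ℝ))
      (systemLaw C U μ) := integrable_of_dependsOn (m := n) fun ω ω' h => by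
    simp only [dependsOn_underCount n j i h]
  have i3 (j : Fin U) : Integrable (fun ω => (sharedCount thr order μ L ε n j ω : ℝ))
      (systemLaw C U μ) := integrable_of_dependsOn (m := n) fun ω ω' h => by
    simp only [dependsOn_sharedCount n j h]
  have i2' : Integrable (fun ω => ∑ j, ∑ i, (underCount thr order μ n j i ω : ℝ))
      (systemLaw C U μ) :=
    integrable_finsetSum _ fun j _ => integrable_finsetSum _ fun i _ => i2 j i
  have i3' : Integrable (fun ω => ∑ j, (sharedCount thr order μ L ε n j ω : ℝ))
      (systemLaw C U μ) := integrable_finsetSum _ fun j _ => i3 j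
  have ia : Integrable (fun ω => (C + n * (if ¬ Alive thr order μ L ε n ω then 1 else 0 : ℝ) : ℝ))
      (systemLaw C U μ) := (integrable_const _).add (i1.const_mul _)
  have ib : Integrable (fun ω => (C + n * (if ¬ Alive thr order μ L ε n ω then 1 else 0 : ℝ) +
      U * (C * L + C) : ℝ)) (systemLaw C U μ) := ia.add (integrable_const _)
  have ic : Integrable (fun ω => (C + n * (if ¬ Alive thr order μ L ε n ω then 1 else 0 : ℝ) +
      U * (C * L + C) + ∑ j, ∑ i, (underCount thr order μ n j i ω : ℝ) : ℝ))
      (systemLaw C U μ) := ib.add i2'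
  refine (integral_mono (integrable_sum_loss n) ((ic.add i3').const_mul _)
    fun ω => sum_loss_le hU hUC hε hL hgap hinj n ω).trans ?_
  simp only [Pi.add_apply]
  rw [integral_const_mul, integral_add ic i3', integral_add ib i2',
    integral_add ia (integrable_const _), integral_add (integrable_const _) (i1.const_mul _),
    integral_const_mul, integral_ite_eq (n := n) (fun ω ω' h => by
      simp only [dependsOn_alive le_rfl h]),
    integral_finsetSum _ fun j _ => i3 j,
    integral_finsetSum _ fun j _ => integrable_finsetSum _ fun i _ => i2 j i]
  simp only [integral_finsetSum _ fun i _ => i2 _ i, integral_const, probReal_univ, one_smul]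
  gcongr
  · calc _ ≤ ∑ _j : Fin U, ∑ _i : Fin C, ∑' t : ℕ, 1 / (t : ℝ) ^ 3 :=
          Finset.sum_le_sum fun j _ => Finset.sum_le_sum fun i _ => integral_underCount_le n j i
      _ = _ := by simp
  · calc _ ≤ ∑ _j : Fin U, U * (C * X + 1) / μ₀ :=
          Finset.sum_le_sum fun j _ => integral_sharedCount_le_div hU hUC hX hthr h0 hμ₀ n j
      _ = _ := by simp

/-- The probability that the system dies is at most of order `1 / n`. -/
lemma exists_mul_systemLaw_dead_le (hU : 1 ≤ U) (hUC : U ≤ C) (hε : 0 < ε)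
    (hgap : ∀ i i', μ i < μ i' → (μ i : ℝ) + 4 * ε ≤ μ i') (hinj : Function.Injective μ)
    {ξ : ℕ → ℕ → ℝ} (hξ : SuperLog fun n => ξ n U) :
    ∃ K : ℝ, ∀ᶠ n : ℕ in atTop, n * (systemLaw C U μ).real
      {ω | ¬ Alive (ξ n) order μ (⌈2 * Real.log n / ε ^ 2⌉₊ + 1) ε n ω} ≤ K := by
  have hC : (1 : ℝ) ≤ C := by exact_mod_cast NeZero.one_le
  have hb := one_lt_base (δ := (1 / (C : ℝ)) ^ U) (by positivity)
    (pow_le_one₀ (by positivity) (by rw [div_le_one (by linarith)]; exact hC)) (potentialBound C U)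
  set b := base ((1 / (C : ℝ)) ^ U) (potentialBound C U) with hbdef
  have hb0 : 0 < b := by linarith
  have hlb : 0 < Real.log b := Real.log_pos hb
  set D : ℝ := U * C with hD
  have hD0 : 0 ≤ D := by positivity
  have hl2 : 0 < Real.log 2 := Real.log_pos (by norm_num)
  -- Chosen so that `ξ n U ≥ M * log n` makes `b ^ ξ n U` at least `n` times the part of `2 ^
  -- budget` that grows with `n`.
  set M : ℝ := (1 + 2 * D * Real.log 2 / ε ^ 2) / Real.log b with hM
  refine ⟨4 * D + 2 * Real.exp (3 * D * Real.log 2 + 2 * Real.log b), ?_⟩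
  filter_upwards [hξ.eventually_ge_atTop M, eventually_ge_atTop 3] with n hn1 hn3
  set l := Real.log n with hl
  have hn0 : (0 : ℝ) < n := by positivity
  have hn1' : (1 : ℝ) ≤ n := by exact_mod_cast (by omega : 1 ≤ n)
  have hlpos : 0 < l := Real.log_pos (by exact_mod_cast (by omega : 1 < n))
  have hexp : Real.exp l = n := Real.exp_log hn0
  -- From this level on the confidence radius is at most `ε`; the added one keeps `L` positive.
  set L := ⌈2 * l / ε ^ 2⌉₊ + 1 with hLdef
  have hε2 : 0 < ε ^ 2 := by positivity
  have hL1 : 2 * l / ε ^ 2 ≤ (L : ℝ) := by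
    rw [hLdef]; push_cast
    have := Nat.le_ceil (2 * l / ε ^ 2)
    linarith
  have hL2 : (L : ℝ) ≤ 2 * l / ε ^ 2 + 2 := by
    rw [hLdef]; push_cast
    have := Nat.ceil_lt_add_one (show 0 ≤ 2 * l / ε ^ 2 by positivity)
    linarith
  have hlog : 2 * l ≤ ε ^ 2 * L := by
    rw [div_le_iff₀ hε2] at hL1
    linarith
  have hthr : M * l ≤ ξ n U := (le_div_iff₀ hlpos).1 hn1
  have hdead := systemLaw_dead_le (thr := ξ n) (order := order) hU hUC hε (Nat.succ_pos _) hgap hinj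
    hlog
  have h1 : (n : ℝ) * ((n + 1) * (U * (C * (2 * Real.exp (-(2 * ε ^ 2 * L)))))) ≤ 4 * D := by
    have e1 : Real.exp (-(2 * ε ^ 2 * L)) ≤ Real.exp (-(2 * l)) :=
      Real.exp_le_exp.2 (by linarith)
    have e2 : Real.exp (-(2 * l)) * (n * n) = 1 := by
      rw [← hexp, ← Real.exp_add, ← Real.exp_add]
      simp; ring
    calc (n : ℝ) * ((n + 1) * (U * (C * (2 * Real.exp (-(2 * ε ^ 2 * L))))))
        ≤ n * ((n + n) * (U * (C * (2 * Real.exp (-(2 * l)))))) := by gcongr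
      _ = 4 * D * (Real.exp (-(2 * l)) * (n * n)) := by rw [hD]; ring
      _ = 4 * D := by rw [e2, mul_one]
  have h2 : (n : ℝ) * (2 / (b ^ (ξ n U - 2) * (1 / 2) ^ (U * (C * L + C)))) ≤
      2 * Real.exp (3 * D * Real.log 2 + 2 * Real.log b) := by
    have e1 : b ^ (ξ n U - 2) * (1 / 2) ^ (U * (C * L + C)) =
        Real.exp (Real.log b * (ξ n U - 2) - (U * (C * L + C)) * Real.log 2) := by
      rw [Real.rpow_def_of_pos hb0, Real.exp_sub, one_div, inv_pow, ← div_eq_mul_inv]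
      congr 1
      have : (2 : ℝ) ^ (U * (C * L + C)) = Real.exp (Real.log 2) ^ (U * (C * L + C)) := by
        rw [Real.exp_log (by norm_num)]
      rw [this, ← Real.exp_nat_mul]
      push_cast
      rfl
    rw [e1, div_eq_mul_inv, ← Real.exp_neg, mul_left_comm]
    refine mul_le_mul_of_nonneg_left ?_ (by norm_num)
    nth_rewrite 1 [← hexp]
    rw [← Real.exp_add]
    refine Real.exp_le_exp.2 ?_
    have e2 : (1 + 2 * D * Real.log 2 / ε ^ 2) * l ≤ Real.log b * ξ n U := by
      have : Real.log b * (M * l) = (1 + 2 * D * Real.log 2 / ε ^ 2) * l := by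
        rw [hM]; field_simp
      rw [← this]
      exact mul_le_mul_of_nonneg_left hthr hlb.le
    have e3 : (U : ℝ) * (C * L + C) * Real.log 2 ≤
        2 * D * Real.log 2 / ε ^ 2 * l + 3 * D * Real.log 2 := by
      have : (U : ℝ) * (C * L + C) ≤ D * (2 * l / ε ^ 2 + 3) := by
        rw [hD]
        calc (U : ℝ) * (C * L + C) = U * C * (L + 1) := by ring
          _ ≤ U * C * (2 * l / ε ^ 2 + 3) :=
            mul_le_mul_of_nonneg_left (by linarith) (by positivity)
      calc (U : ℝ) * (C * L + C) * Real.log 2 ≤ D * (2 * l / ε ^ 2 + 3) * Real.log 2 := by gcongr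
        _ = _ := by ring
    linarith
  calc _ ≤ (n : ℝ) * ((n + 1) * (U * (C * (2 * Real.exp (-(2 * ε ^ 2 * L))))) +
          2 / (b ^ (ξ n U - 2) * (1 / 2) ^ (U * (C * L + C)))) := by gcongr
    _ ≤ _ := by rw [mul_add]; exact add_le_add h1 h2

/-- Every term is `O(1)`, `O(log n)` or linear in the largest threshold, and the latter eventually
exceeds both `1` and `log n`. -/
theorem exists_regret_le (hU : 1 ≤ U) (hUC : U ≤ C) (hpos : ∀ i, 0 < μ i)
    (hinj : Function.Injective μ) {ξ : ℕ → ℕ → ℝ} (hξ : SuperLog fun n => ξ n U) :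
    ∃ K : ℝ, ∀ᶠ n : ℕ in atTop,
      0 < maxThreshold ξ U n ∧ regret C U μ order ξ n ≤ K * maxThreshold ξ U n := by
  obtain ⟨ε, hε, hgap⟩ := exists_gap μ
  obtain ⟨i₀, hi₀⟩ := Finite.exists_min fun i => (μ i : ℝ)
  have h0 : (0 : ℝ) < μ i₀ := hpos i₀
  obtain ⟨K, hK⟩ := exists_mul_systemLaw_dead_le (order := order) hU hUC hε hgap hinj hξ
  set S : ℝ := ∑' t : ℕ, 1 / (t : ℝ) ^ 3 with hS
  have hS0 : 0 ≤ S := tsum_nonneg fun t => by positivity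
  refine ⟨U * (C + |K| + U * (C * (2 / ε ^ 2 + 2) + C) + U * (C * S) +
    U * (U * (C + 1) / μ i₀)), ?_⟩
  filter_upwards [hK, hξ.eventually_ge_atTop 1, eventually_ge_atTop 3] with n hn1 hn2 hn3
  set l := Real.log n with hl
  have hl1 : 1 ≤ l := by
    rw [hl, Real.le_log_iff_exp_le (by positivity)]
    have : (3 : ℝ) ≤ n := by exact_mod_cast hn3
    linarith [Real.exp_one_lt_d9]
  set X := maxThreshold ξ U n with hX
  have hlX : l ≤ X := by
    have h1 : 1 * l ≤ ξ n U := (le_div_iff₀ (by linarith)).1 hn2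
    have h2 := le_maxThreshold (U := U) ξ n hU le_rfl
    linarith
  have hX1 : 1 ≤ X := hl1.trans hlX
  refine ⟨by linarith, ?_⟩
  rw [regret_eq]
  refine (integral_sum_loss_le hU hUC hε (Nat.succ_pos ⌈2 * l / ε ^ 2⌉₊) hgap hinj
    (by linarith : 0 ≤ X) (fun k h1 h2 => le_maxThreshold ξ n h1 h2) h0 hi₀ n).trans ?_
  have hL2 : ((⌈2 * l / ε ^ 2⌉₊ + 1 : ℕ) : ℝ) ≤ (2 / ε ^ 2 + 2) * X := by
    push_cast
    have h1 := Nat.ceil_lt_add_one (show 0 ≤ 2 * l / ε ^ 2 by positivity)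
    have h2 : 2 * l / ε ^ 2 ≤ 2 / ε ^ 2 * X := by
      rw [mul_div_right_comm]
      gcongr
    linarith
  rw [mul_assoc, add_mul, add_mul, add_mul, add_mul]
  have hK' : n * (systemLaw C U μ).real
      {ω | ¬ Alive (ξ n) order μ (⌈2 * l / ε ^ 2⌉₊ + 1) ε n ω} ≤ |K| * X :=
    (hn1.trans (le_abs_self K)).trans (le_mul_of_one_le_right (abs_nonneg K) hX1)
  refine mul_le_mul_of_nonneg_left (add_le_add (add_le_add (add_le_add (add_le_add ?_ hK') ?_) ?_)
    ?_) (by positivity)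
  · exact le_mul_of_one_le_right (by positivity) hX1
  · rw [mul_assoc, add_mul, mul_assoc]
    exact mul_le_mul_of_nonneg_left (add_le_add (mul_le_mul_of_nonneg_left hL2 (by positivity))
      (le_mul_of_one_le_right (by positivity) hX1)) (by positivity)
  · exact le_mul_of_one_le_right (by positivity) hX1
  · rw [mul_assoc, div_mul_eq_mul_div, mul_assoc, add_mul, one_mul]
    gcongr

end Bound

end CognitiveRadio

-- The limsup is taken in `EReal`, where being below `⊤` expresses boundedness; the limsup in `ℝ` of
-- a sequence unbounded above would be a default value.
open CognitiveRadio in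
theorem mainTheorem2 :
    (∀ (C U : ℕ) [NeZero C], 1 ≤ U → U ≤ C →
      ∀ μ : Fin C → I, (∀ i, 0 < μ i ∧ μ i < 1) → Function.Injective μ →
      ∀ (order : Fin U → Equiv.Perm (Fin C)) (ξ : ℕ → ℕ → ℝ),
        (∀ k, 1 < k → k ≤ C → SuperLog fun n => ξ n k) →
        SuperLog (maxThreshold ξ U) →
        limsup (fun n => ((regret C U μ order ξ n / maxThreshold ξ U n : ℝ) : EReal)) atTop < ⊤) ∧
    (∀ f : ℕ → ℝ, Tendsto f atTop atTop →
      ∃ ξ : ℕ → ℕ → ℝ, (∀ k, 1 < k → SuperLog fun n => ξ n k) ∧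
        ∀ (C U : ℕ) [NeZero C], 1 ≤ U → U ≤ C →
          ∀ μ : Fin C → I, (∀ i, 0 < μ i ∧ μ i < 1) → Function.Injective μ →
          ∀ order : Fin U → Equiv.Perm (Fin C),
            regret C U μ order ξ =O[atTop] fun n => f n * Real.log n) := by
  constructor
  · intro C U _ hU hUC μ hμ hinj order ξ hξ hmax
    -- Overestimation starts at estimate `U`, so growth is needed of that threshold; for `U = 1` it
    -- is the maximum itself.
    have hsup : SuperLog fun n => ξ n U := by
      rcases hU.eq_or_lt with h | h
      · subst h
        have : maxThreshold ξ 1 = fun n => ξ n 1 := by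
          funext n
          simp [maxThreshold]
        rwa [← this]
      · exact hξ U h hUC
    obtain ⟨K, hK⟩ := exists_regret_le (order := order) hU hUC (fun i => (hμ i).1) hinj hsup
    refine lt_of_le_of_lt (limsup_le_of_le (a := ((K : ℝ) : EReal)) (by isBoundedDefault) ?_)
      (EReal.coe_lt_top K)
    filter_upwards [hK] with n hn
    exact EReal.coe_le_coe_iff.2 ((div_le_iff₀ hn.1).2 hn.2)
  · intro f hf
    have hsup : SuperLog fun n => f n * Real.log n := by
      refine hf.congr' ?_
      filter_upwards [eventually_ge_atTop 2] with n hn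
      have : 0 < Real.log n := Real.log_pos (by exact_mod_cast hn)
      field_simp
    -- Thresholds constant in `k` coincide with their maximum for every `U`.
    refine ⟨fun n _ => f n * Real.log n, fun k _ => hsup, ?_⟩
    intro C U _ hU hUC μ hμ hinj order
    obtain ⟨K, hK⟩ := exists_regret_le (order := order) (ξ := fun n _ => f n * Real.log n) hU hUC
      (fun i => (hμ i).1) hinj hsup
    refine IsBigO.of_bound K ?_
    filter_upwards [hK] with n hn
    have : Nonempty (Fin U) := ⟨⟨0, hU⟩⟩
    have hmax : maxThreshold (fun n _ => f n * Real.log n) U n = f n * Real.log n := by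
      simp [maxThreshold]
    rw [hmax] at hn
    rw [Real.norm_of_nonneg (regret_nonneg hUC _ n), Real.norm_of_nonneg hn.1.le]
    exact hn.2
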